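/- Setting. Let $S$ be a finite set and, for each $\lambda>0$, let $Q(\lambda)=(q_{ij}(\lambda))$ be an irreducible transition rate matrix on $S$ (nonnegative off-diagonal entries, zero row sums). Put $q_i(\lambda)=-q_{ii}(\lambda)$, and let $\Omega(\lambda)=(\omega_{ij}(\lambda))$ be the transition matrix of the jump chain: $\omega_{ij}(\lambda)=q_{ij}(\lambda)/q_i(\lambda)$ for $i\ne j$ and $\omega_{ii}(\lambda)=0$. Assume that for all $i\neq j$ the limit of $q_{ij}(\lambda)$ as $\lambda\to\infty$ exists in $[0,\infty]$ and $\lim_{\lambda\to\infty}\omega_{ij}(\lambda)$ exists. Let $q_{ij}$, $q_i\in[0,\infty]$ and $\Omega=(\omega_{ij})$ be the limits, let $A=\{i: q_i=\infty\}$ be the set of fast states and $B=\{i: q_i<\infty\}$ the set of slow states. Assume that $B\ne\emptyset$, that $q_i>0$ for all $i\in B$, and that the discrete-time Markov chain with transition matrix $\Omega$ started at any $i\in A$ almost surely visits $B$. Write $Q_{BB},Q_{BA},\Omega_{AA},\Omega_{AB}$ for the blocks of the limit matrices, and let $$\Gamma=Q_{BB}+Q_{BA}(I-\Omega_{AA})^{-1}\Omega_{AB}.$$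 The reduced chain $Y$ is the continuous-time Markov chain on $B$ with transition rate matrix $\Gamma$. Let $P^\lambda_i$ be the law of the continuous-time Markov chain $X$ with rate matrix $Q(\lambda)$ started at $i$, and $P_i$ the law of $Y$ started at $i$. Theorem 3. If the reduced chain $Y$ is irreducible, then for all $i,j\in B$, $$\lim_{\lambda\to\infty}\ \sup_{t\ge 0}\left|P^\lambda_i(X_t=j)-P_i(Y_t=j)\right|=0 .$$ The conclusion can fail if $Y$ is not irreducible: for $S=\{1,2,3,4\}$ and $$Q(\lambda)=\begin{pmatrix}-(\lambda+1)&1&\lambda&0\\1&-(\lambda+1)&0&\lambda\\1&0&-(\tfrac1\lambda+1)&\tfrac1\lambda\\0&1&\tfrac1\lambda&-(\tfrac1\lambda+1)\end{pmatrix}$$ all assumptions of the setting hold, $3$ and $4$ are slow states, $Y$ is not irreducible, and $\sup_{t\ge0}|P^\lambda_3(X_t=4)-P_3(Y_t=4)|$ does not tend to $0$ as $\lambda\to\infty$. -/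

import Mathlib

open Filter Topology MeasureTheory
open scoped NNReal

universe u v w

noncomputable section

namespace TwoTimeScale

/-- A transition rate matrix on a finite state space. -/
structure IsRateMatrix {S : Type*} [Fintype S] (G : Matrix S S ℝ) : Prop where
  nonneg : ∀ i j, i ≠ j → 0 ≤ G i j
  row_sum : ∀ i, ∑ j, G i j = 0

/-- Irreducibility of a transition rate matrix: any state can be reached from any other one
along transitions of positive rate. -/
def IsIrreducible {S : Type*} (G : Matrix S S ℝ) : Prop :=
  ∀ i j, Relation.ReflTransGen (fun a b => a ≠ b ∧ 0 < G a b) i j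

/-- `X` is, under `P`, a continuous-time Markov chain with transition rate matrix `G` started
at `i`: its paths are right-continuous and, given the past at finitely many times, the next
value is distributed according to the transition semigroup `exp (t G)`. -/
structure IsMarkovChain {S : Type*} [Fintype S] [DecidableEq S] {Ω : Type*} [MeasurableSpace Ω]
    (G : Matrix S S ℝ) (i : S) (P : Measure Ω) (X : ℝ≥0 → Ω → S) : Prop where
  isProbabilityMeasure : IsProbabilityMeasure P
  measurableSet_eq : ∀ t j, MeasurableSet {ω | X t ω = j}
  rightContinuous : ∀ ω t, ∀ᶠ s in 𝓝[≥] t, X s ω = X t ω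
  start : P.real {ω | X 0 ω = i} = 1
  markov : ∀ (n : ℕ) (t : ℕ → ℝ≥0), Monotone t → ∀ s : ℕ → S,
    P.real {ω | ∀ k ≤ n + 1, X (t k) ω = s k} =
      P.real {ω | ∀ k ≤ n, X (t k) ω = s k} *
        NormedSpace.exp (((t (n + 1) : ℝ) - (t n : ℝ)) • G) (s n) (s (n + 1))

/-- `η` is, under `P`, a discrete-time Markov chain with transition probability matrix `M`
started at `i`. -/
structure IsDiscreteMarkovChain {S : Type*} {Ω : Type*} [MeasurableSpace Ω]
    (M : Matrix S S ℝ) (i : S) (P : Measure Ω) (η : ℕ → Ω → S) : Prop where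
  isProbabilityMeasure : IsProbabilityMeasure P
  measurableSet_eq : ∀ n j, MeasurableSet {ω | η n ω = j}
  start : P.real {ω | η 0 ω = i} = 1
  markov : ∀ (n : ℕ) (s : ℕ → S),
    P.real {ω | ∀ k ≤ n + 1, η k ω = s k} =
      P.real {ω | ∀ k ≤ n, η k ω = s k} * M (s n) (s (n + 1))

section Reduction

variable {S : Type*} (Q : ℝ → Matrix S S ℝ)

/-- The total rate `q_i(l) = -q_ii(l)` of leaving `i` tends to infinity. -/
def IsFast (i : S) : Prop := Tendsto (fun l => -Q l i i) atTop atTop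

/-- The total rate `q_i(l) = -q_ii(l)` of leaving `i` has a finite limit. -/
def IsSlow (i : S) : Prop := ∃ c : ℝ, Tendsto (fun l => -Q l i i) atTop (𝓝 c)

abbrev FastState : Type _ := {i : S // IsFast Q i}

abbrev SlowState : Type _ := {i : S // IsSlow Q i}

instance [Finite S] : Fintype (FastState Q) := Fintype.ofFinite _

instance [Finite S] : Fintype (SlowState Q) := Fintype.ofFinite _

/-- The entries of the limit of `Q`; only used in the rows of slow states, where the limits
are finite. -/
def limitRate (i j : S) : ℝ := limUnder atTop (fun l => Q l i j)

variable [DecidableEq S]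

/-- The transition matrix of the jump chain of a chain with rate matrix `G`. -/
def jumpMatrix (G : Matrix S S ℝ) : Matrix S S ℝ :=
  fun i j => if i = j then 0 else G i j / (-G i i)

/-- The limit of the transition matrices of the jump chains. -/
def limitJump : Matrix S S ℝ := fun i j => limUnder atTop (fun l => jumpMatrix (Q l) i j)

/-- The transition rate matrix `Q_BB + Q_BA (1 - Ω_AA)⁻¹ Ω_AB` of the reduced chain, where `A`
is the set of fast states and `B` the set of slow states. -/
def reducedRate [Fintype S] : Matrix (SlowState Q) (SlowState Q) ℝ :=
  let QBB : Matrix (SlowState Q) (SlowState Q) ℝ := fun i j => limitRate Q i j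
  let QBA : Matrix (SlowState Q) (FastState Q) ℝ := fun i j => limitRate Q i j
  let ΩAA : Matrix (FastState Q) (FastState Q) ℝ := fun i j => limitJump Q i j
  let ΩAB : Matrix (FastState Q) (SlowState Q) ℝ := fun i j => limitJump Q i j
  QBB + QBA * (1 - ΩAA)⁻¹ * ΩAB

/-- The standing assumptions on a two-time-scale family of transition rate matrices. In
`hits_slow`, the law of the chain is determined by its transition matrix and its initial
state, so it does not matter which realization of the chain is used. -/
structure IsTwoTimeScale [Fintype S] : Prop where
  isRateMatrix : ∀ l > 0, IsRateMatrix (Q l)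
  isIrreducible : ∀ l > 0, IsIrreducible (Q l)
  tendsto_rate : ∀ i j, i ≠ j →
    (∃ c : ℝ, Tendsto (fun l => Q l i j) atTop (𝓝 c)) ∨ Tendsto (fun l => Q l i j) atTop atTop
  tendsto_jump : ∀ i j, i ≠ j →
    ∃ w : ℝ, Tendsto (fun l => jumpMatrix (Q l) i j) atTop (𝓝 w)
  exists_slow : ∃ i, IsSlow Q i
  slow_pos : ∀ i, ∀ c : ℝ, Tendsto (fun l => -Q l i i) atTop (𝓝 c) → 0 < c
  hits_slow : ∀ i, IsFast Q i →
    ∃ (Ω : Type) (_ : MeasurableSpace Ω) (P : Measure Ω) (η : ℕ → Ω → S),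
      IsDiscreteMarkovChain (limitJump Q) i P η ∧ P {ω | ∃ n, IsSlow Q (η n ω)} = 1

end Reduction

/-- A family on four states whose reduced chain is not irreducible. -/
def exampleRate (l : ℝ) : Matrix (Fin 4) (Fin 4) ℝ :=
  !![-(l + 1), 1, l, 0;
     1, -(l + 1), 0, l;
     1, 0, -(1 / l + 1), 1 / l;
     0, 1, 1 / l, -(1 / l + 1)]

end TwoTimeScale

end

/-! Write Q for Q(λ), let E(k,c) be the probability that the limit jump chain started at k first
visits the slow states at c, and let M be the limit of Q after the row of each fast state k has been
divided by its rate d_k = q_k(λ), with d_k = 1 for slow k. Then ME = Γ in the slow rows and ME = 0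
in the fast rows. Hence U(s) = E exp(sΓ) e_j nearly solves the backward equation U' = QU.

The two semigroups are compared through f(s) = ∑_k exp((t-s)Q)(i,k) U(s)(k). Its value at s = t is
exp(tΓ)(i,j); its value at s = 0 differs from exp(tQ)(i,j) only by mass in fast states. Its
derivative is the defect U' - QU averaged over exp((t-s)Q)(i,·). Two estimates make the integral of
the derivative small uniformly in t (`abs_exp_sub_exp_reduced_le`).

In space: the defect at k may be as large as d_k times a small factor, but exp(tQ)(i,k) d_k stays
bounded in t and λ (`IsTwoTimeScale.exists_exp_mul_timeScale_le`), by comparison with a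
supersolution built from (1 - Ω_AA)⁻¹. A minimum principle gives existence and positivity of this
inverse, because slow states are reachable from every fast one.

In time: the relevant matrices have zero row sums, so only oscillations of U(s) matter. If Γ is
irreducible, these decay like exp(-αs) (`IsRateMatrix.exists_exp_decay`), which is integrable over
the whole half-line.

In the example Γ = 0, so Y never moves, whereas Q is irreducible with invariant measure (1,1,λ,λ); X
therefore eventually shares its mass almost equally between both slow states. -/

namespace TwoTimeScale

/-! ### Matrix semigroups: positivity, conservation, comparison and mixing -/

section MatrixExponential

variable {S : Type*} [Fintype S] [DecidableEq S]

section
attribute [local instance] Matrix.linftyOpNormedRing Matrix.linftyOpNormedAlgebra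

theorem hasDerivAt_exp_smul (G : Matrix S S ℝ) (t : ℝ) :
    HasDerivAt (fun s : ℝ => NormedSpace.exp (s • G)) (NormedSpace.exp (t • G) * G) t := by
  exact hasDerivAt_exp_smul_const G t

theorem hasSum_exp (G : Matrix S S ℝ) :
    HasSum (fun n : ℕ => ((n.factorial : ℝ)⁻¹) • G ^ n) (NormedSpace.exp G) := by
  exact NormedSpace.exp_series_hasSum_exp' G
end

theorem exp_add_smul (G : Matrix S S ℝ) (s t : ℝ) :
   NormedSpace.exp ((s + t) • G) = NormedSpace.exp (s • G) * NormedSpace.exp (t • G) := by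
  rw [add_smul]
  exact Matrix.exp_add_of_commute _ _ (((Commute.refl G).smul_left s).smul_right t)

theorem hasSum_exp_apply (G : Matrix S S ℝ) (i j : S) :
    HasSum (fun n : ℕ => ((n.factorial : ℝ)⁻¹) * (G ^ n) i j) (NormedSpace.exp G i j) := by
  have := (Pi.hasSum.1 (Pi.hasSum.1 (hasSum_exp G) i)) j
  exact this

theorem hasDerivAt_exp_smul_apply (G : Matrix S S ℝ) (t : ℝ) (i j : S) :
    HasDerivAt (fun s : ℝ => NormedSpace.exp (s • G) i j)
      (∑ k, NormedSpace.exp (t • G) i k * G k j) t := by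
  have := (hasDerivAt_pi.1 (hasDerivAt_pi.1 (hasDerivAt_exp_smul G t) i)) j
  exact this

theorem hasDerivAt_exp_smul_apply_left (G : Matrix S S ℝ) (t : ℝ) (i j : S) :
    HasDerivAt (fun s : ℝ => NormedSpace.exp (s • G) i j)
      (∑ k, G i k * NormedSpace.exp (t • G) k j) t := by
  have h : NormedSpace.exp (t • G) * G = G * NormedSpace.exp (t • G) :=
    (((Commute.refl G).smul_left t).exp_left).eq
  have h' := congrFun (congrFun h i) j
  rw [Matrix.mul_apply, Matrix.mul_apply] at h'
  rw [← h']
  exact hasDerivAt_exp_smul_apply G t i j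

/-- Scalar matrices commute with everything. For large c the shifted matrix has nonnegative entries,
so signs can be read off its exponential series. -/
theorem exp_apply_eq_shift (G : Matrix S S ℝ) (c : ℝ) (i j : S) :
    NormedSpace.exp G i j = Real.exp (-c) * NormedSpace.exp (G + c • (1 : Matrix S S ℝ)) i j := by
  have h1 : NormedSpace.exp ((-c) • (1 : Matrix S S ℝ)) = Real.exp (-c) • (1 : Matrix S S ℝ) := by
    rw [← Matrix.diagonal_one, ← Matrix.diagonal_smul, Matrix.exp_diagonal,
      ← Matrix.diagonal_smul]
    congr 1
    ext k
    rw [Pi.coe_exp]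
    simp [Real.exp_eq_exp_ℝ]
  have h2 : G = (-c) • (1 : Matrix S S ℝ) + (G + c • (1 : Matrix S S ℝ)) := by
    rw [neg_smul]; abel
  conv_lhs => rw [h2]
  rw [Matrix.exp_add_of_commute _ _ ((Commute.one_left _).smul_left _), h1, smul_mul_assoc, one_mul]
  rfl

theorem pow_apply_nonneg {N : Matrix S S ℝ} (hN : ∀ i j, 0 ≤ N i j) (n : ℕ) (i j : S) :
    0 ≤ (N ^ n) i j := by
  induction n generalizing i j with
  | zero => rw [pow_zero, Matrix.one_apply]; split_ifs <;> norm_num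
  | succ n ih =>
    rw [pow_succ, Matrix.mul_apply]
    exact Finset.sum_nonneg fun k _ => mul_nonneg (ih i k) (hN k j)

theorem exists_shift_nonneg {G : Matrix S S ℝ} (hG : ∀ i j, i ≠ j → 0 ≤ G i j) :
    ∃ c : ℝ, ∀ i j, 0 ≤ (G + c • (1 : Matrix S S ℝ)) i j := by
  refine ⟨∑ i, |G i i|, fun i j => ?_⟩
  rw [Matrix.add_apply, Matrix.smul_apply, Matrix.one_apply]
  split_ifs with h
  · subst h
    have := Finset.single_le_sum (f := fun i => |G i i|) (fun k _ => abs_nonneg _)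
      (Finset.mem_univ i)
    have h2 := neg_abs_le (G i i)
    simp only [smul_eq_mul, mul_one]
    linarith
  · simpa using hG i j h

theorem exp_apply_nonneg {G : Matrix S S ℝ} (hG : ∀ i j, i ≠ j → 0 ≤ G i j) (i j : S) :
    0 ≤ NormedSpace.exp G i j := by
  obtain ⟨c, hc⟩ := exists_shift_nonneg hG
  rw [exp_apply_eq_shift G c]
  exact mul_nonneg (Real.exp_pos _).le ((hasSum_exp_apply _ i j).nonneg fun n =>
    mul_nonneg (by positivity) (pow_apply_nonneg hc n i j))

theorem exp_smul_apply_nonneg {G : Matrix S S ℝ} (hG : ∀ i j, i ≠ j → 0 ≤ G i j) {t : ℝ}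
    (ht : 0 ≤ t) (i j : S) : 0 ≤ NormedSpace.exp (t • G) i j :=
  exp_apply_nonneg (fun i j h => mul_nonneg ht (hG i j h)) i j

/-- A path of n positive rates from i to j makes the (i,j) entry of the n-th power of the shifted
matrix positive, and all other terms of the series are nonnegative. -/
theorem exp_apply_pos {G : Matrix S S ℝ} (hG : ∀ i j, i ≠ j → 0 ≤ G i j)
    (hirr : IsIrreducible G) (i j : S) : 0 < NormedSpace.exp G i j := by
  obtain ⟨c, hc⟩ := exists_shift_nonneg hG
  have key : ∃ n : ℕ, 0 < ((G + c • (1 : Matrix S S ℝ)) ^ n) i j := by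
    induction hirr i j with
    | refl => exact ⟨0, by simp⟩
    | @tail b d _ hbd ih =>
      obtain ⟨n, hn⟩ := ih
      refine ⟨n + 1, ?_⟩
      rw [pow_succ, Matrix.mul_apply]
      refine Finset.sum_pos' (fun k _ => mul_nonneg (pow_apply_nonneg hc n i k) (hc k d))
        ⟨b, Finset.mem_univ b, mul_pos hn ?_⟩
      rw [Matrix.add_apply, Matrix.smul_apply, Matrix.one_apply_ne hbd.1]
      simpa using hbd.2
  obtain ⟨n, hn⟩ := key
  rw [exp_apply_eq_shift G c]
  refine mul_pos (Real.exp_pos _) ?_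
  have h0 : 0 < ((n.factorial : ℝ)⁻¹) * ((G + c • (1 : Matrix S S ℝ)) ^ n) i j := by positivity
  exact h0.trans_le (le_hasSum (hasSum_exp_apply _ i j) n fun m _ =>
    mul_nonneg (by positivity) (pow_apply_nonneg hc m i j))

/-- The derivative of exp(tG)f is exp(tG)Gf = 0. The choice f = 1 gives conservation of mass;
transposition gives preservation of invariant measures. -/
theorem sum_exp_smul_mul_eq {G : Matrix S S ℝ} {f : S → ℝ} (hf : ∀ i, ∑ j, G i j * f j = 0)
    (t : ℝ) (i : S) : ∑ j, NormedSpace.exp (t • G) i j * f j = f i := by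
  have hd : ∀ s : ℝ, HasDerivAt (fun s : ℝ => ∑ j, NormedSpace.exp (s • G) i j * f j) 0 s := by
    intro s
    refine (HasDerivAt.fun_sum (u := Finset.univ)
      fun j _ => (hasDerivAt_exp_smul_apply G s i j).mul_const (f j)).congr_deriv ?_
    simp_rw [Finset.sum_mul]
    rw [Finset.sum_comm]
    refine Finset.sum_eq_zero fun k _ => ?_
    simp_rw [mul_assoc]
    rw [← Finset.mul_sum, hf, mul_zero]
  have := is_const_of_deriv_eq_zero (fun s => (hd s).differentiableAt) (fun s => (hd s).deriv) t 0
  simpa [Matrix.one_apply] using this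

theorem sum_mul_exp_smul_eq {G : Matrix S S ℝ} {p : S → ℝ} (hp : ∀ j, ∑ i, p i * G i j = 0)
    (t : ℝ) (j : S) : ∑ i, p i * NormedSpace.exp (t • G) i j = p j := by
  have h := sum_exp_smul_mul_eq (G := G.transpose) (f := p)
    (fun i => by simpa [Matrix.transpose_apply, mul_comm] using hp i) t j
  rw [← Matrix.transpose_smul, Matrix.exp_transpose] at h
  simpa [Matrix.transpose_apply, mul_comm] using h

theorem IsRateMatrix.exp_nonneg {G : Matrix S S ℝ} (hG : IsRateMatrix G) {t : ℝ} (ht : 0 ≤ t)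
    (i j : S) : 0 ≤ NormedSpace.exp (t • G) i j :=
  exp_smul_apply_nonneg hG.nonneg ht i j

theorem IsRateMatrix.sum_exp {G : Matrix S S ℝ} (hG : IsRateMatrix G) (t : ℝ) (i : S) :
    ∑ j, NormedSpace.exp (t • G) i j = 1 := by
  simpa using sum_exp_smul_mul_eq (G := G) (f := fun _ => 1) (by simpa using hG.row_sum) t i

theorem IsRateMatrix.exp_le_one {G : Matrix S S ℝ} (hG : IsRateMatrix G) {t : ℝ} (ht : 0 ≤ t)
    (i j : S) : NormedSpace.exp (t • G) i j ≤ 1 := by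
  rw [← hG.sum_exp t i]
  exact Finset.single_le_sum (fun k _ => hG.exp_nonneg ht i k) (Finset.mem_univ j)

/-- A comparison principle for the differential inequality `v' ≥ v G`. -/
theorem nonneg_of_deriv_ge_vecMul {G : Matrix S S ℝ} (hG : ∀ i j, i ≠ j → 0 ≤ G i j)
    {v v' : ℝ → S → ℝ} (hv : ∀ s j, HasDerivAt (fun r => v r j) (v' s j) s)
    (hle : ∀ s, 0 ≤ s → ∀ j, ∑ k, v s k * G k j ≤ v' s j) (h0 : ∀ j, 0 ≤ v 0 j)
    {t : ℝ} (ht : 0 ≤ t) (j : S) : 0 ≤ v t j := by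
  -- The interpolation v(s) exp((t-s)G) has the nonnegative derivative (v' - vG) exp((t-s)G) on
  -- [0,t]. It runs from the nonnegative vector v(0) exp(tG) to v(t).
  have hd : ∀ s : ℝ, HasDerivAt (fun s : ℝ => ∑ k, v s k * NormedSpace.exp ((t - s) • G) k j)
      (∑ k, (v' s k - ∑ l, v s l * G l k) * NormedSpace.exp ((t - s) • G) k j) s := by
    intro s
    have hE : ∀ k, HasDerivAt (fun s : ℝ => NormedSpace.exp ((t - s) • G) k j)
        (-(∑ l, G k l * NormedSpace.exp ((t - s) • G) l j)) s := fun k => by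
      have := (hasDerivAt_exp_smul_apply_left G (t - s) k j).comp s
        ((hasDerivAt_id s).const_sub t)
      simpa [Function.comp_def] using this
    refine (HasDerivAt.fun_sum (u := Finset.univ)
      fun k _ => (hv s k).fun_mul (hE k)).congr_deriv ?_
    simp_rw [sub_mul, mul_neg, Finset.sum_add_distrib, Finset.sum_sub_distrib,
      Finset.sum_neg_distrib, sub_eq_add_neg]
    congr 2
    simp_rw [Finset.sum_mul, Finset.mul_sum]
    rw [Finset.sum_comm]
    simp_rw [mul_assoc]
  have hmono : MonotoneOn (fun s : ℝ => ∑ k, v s k * NormedSpace.exp ((t - s) • G) k j)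
      (Set.Icc 0 t) := by
    refine monotoneOn_of_deriv_nonneg (convex_Icc 0 t)
      (fun s _ => (hd s).continuousAt.continuousWithinAt)
      (fun s _ => (hd s).differentiableAt.differentiableWithinAt) fun s hs => ?_
    rw [(hd s).deriv]
    rw [interior_Icc] at hs
    exact Finset.sum_nonneg fun k _ => mul_nonneg (sub_nonneg.2 (hle s hs.1.le k))
      (exp_smul_apply_nonneg hG (sub_nonneg.2 hs.2.le) k j)
  have h := hmono (Set.left_mem_Icc.2 ht) (Set.right_mem_Icc.2 ht) ht
  simp only [sub_self, zero_smul, NormedSpace.exp_zero, Matrix.one_apply, mul_ite, mul_one,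
    mul_zero, Finset.sum_ite_eq', Finset.mem_univ, if_true] at h
  exact (Finset.sum_nonneg fun k _ => mul_nonneg (h0 k)
    (exp_smul_apply_nonneg hG (by linarith) k j)).trans h

/-- A stochastic matrix with entries at least `δ` contracts oscillations by `1 - δ`. -/
theorem abs_sub_le_of_stochastic {R T : Type*} [Fintype T] {P : Matrix R T ℝ} {δ : ℝ}
    (hδ : 0 ≤ δ) (hP : ∀ i j, δ ≤ P i j) (hsum : ∀ i, ∑ j, P i j = 1) {g : T → ℝ} {D : ℝ}
    (hg : ∀ a b, |g a - g b| ≤ D) (x y : R) :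
    |∑ j, P x j * g j - ∑ j, P y j * g j| ≤ (1 - δ) * D := by
  have key : ∀ x y, ∑ j, P x j * g j - ∑ j, P y j * g j ≤ (1 - δ) * D := by
    intro x y
    have : Nonempty T := by
      by_contra hT
      rw [not_nonempty_iff] at hT
      simpa using hsum x
    obtain ⟨a, ha⟩ := Finite.exists_max g
    obtain ⟨b, hb⟩ := Finite.exists_min g
    -- Row x puts mass at least δ on the minimizer b, so its average stays δ(g a - g b) below the
    -- maximum; the average over row y is at least the minimum.
    have h1 : ∑ j, P x j * (g a - g j) ≥ δ * (g a - g b) :=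
      (mul_le_mul_of_nonneg_right (hP x b) (sub_nonneg.2 (hb a))).trans
        (Finset.single_le_sum (f := fun j => P x j * (g a - g j))
          (fun j _ => mul_nonneg (hδ.trans (hP x j)) (sub_nonneg.2 (ha j))) (Finset.mem_univ b))
    have h2 : ∑ j, P y j * (g j - g b) ≥ 0 :=
      Finset.sum_nonneg fun j _ => mul_nonneg (hδ.trans (hP y j)) (sub_nonneg.2 (hb j))
    simp_rw [mul_sub, Finset.sum_sub_distrib, ← Finset.sum_mul, hsum, one_mul] at h1 h2
    have h3 := (le_abs_self _).trans (hg a b)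
    have h4 : δ ≤ 1 := by
      rw [← hsum x]
      exact (hP x a).trans (Finset.single_le_sum (fun j _ => hδ.trans (hP x j))
        (Finset.mem_univ a))
    nlinarith
  exact abs_sub_le_iff.2 ⟨key x y, key y x⟩

/-- Doeblin's argument: by irreducibility all entries of exp G are at least some δ > 0, so each unit
of time contracts oscillations by the factor 1 - δ. -/
theorem IsRateMatrix.exists_exp_decay {G : Matrix S S ℝ} (hG : IsRateMatrix G)
    (hirr : IsIrreducible G) :
    ∃ K α : ℝ, 0 < α ∧ 0 ≤ K ∧ ∀ (g : S → ℝ), (∀ a b, |g a - g b| ≤ 1) →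
      ∀ t : ℝ, 0 ≤ t → ∀ x y, |∑ j, NormedSpace.exp (t • G) x j * g j
        - ∑ j, NormedSpace.exp (t • G) y j * g j| ≤ K * Real.exp (-α * t) := by
  obtain ⟨δ, hδ0, hδ1, hδ⟩ : ∃ δ : ℝ, 0 < δ ∧ δ < 1 ∧ ∀ i j, δ ≤ NormedSpace.exp G i j := by
    rcases isEmpty_or_nonempty S with h | h
    · exact ⟨1 / 2, by norm_num, by norm_num, fun i => isEmptyElim i⟩
    · obtain ⟨p, hp⟩ := Finite.exists_min fun p : S × S => NormedSpace.exp G p.1 p.2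
      -- The cap 1/2 keeps 1 - δ positive, so that its logarithm can serve as the decay exponent.
      refine ⟨min (1 / 2) (NormedSpace.exp G p.1 p.2), lt_min (by norm_num)
        (exp_apply_pos hG.nonneg hirr _ _), (min_le_left _ _).trans_lt (by norm_num),
        fun i j => (min_le_right _ _).trans (hp (i, j))⟩
  have hρ : 0 < 1 - δ := by linarith
  have hsum1 : ∀ i, ∑ j, NormedSpace.exp G i j = 1 := fun i => by
    simpa using hG.sum_exp 1 i
  have hnat : ∀ (n : ℕ) (g : S → ℝ), (∀ a b, |g a - g b| ≤ 1) → ∀ x y,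
      |∑ j, NormedSpace.exp ((n : ℝ) • G) x j * g j
        - ∑ j, NormedSpace.exp ((n : ℝ) • G) y j * g j| ≤ (1 - δ) ^ n := by
    intro n g hg
    induction n with
    | zero => simpa [Matrix.one_apply] using hg
    | succ n ih =>
      intro x y
      have hs : ∀ x, ∑ j, NormedSpace.exp (((n + 1 : ℕ) : ℝ) • G) x j * g j
          = ∑ k, NormedSpace.exp G x k * ∑ j, NormedSpace.exp ((n : ℝ) • G) k j * g j := by
        intro x
        rw [Nat.cast_succ, add_comm, exp_add_smul, one_smul]
        simp_rw [Matrix.mul_apply, Finset.sum_mul, Finset.mul_sum]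
        rw [Finset.sum_comm]
        simp_rw [mul_assoc]
      rw [hs, hs, pow_succ, mul_comm]
      exact abs_sub_le_of_stochastic hδ0.le hδ hsum1 ih x y
  -- Contraction is used only over the ⌊t⌋ whole units of time; the factor (1 - δ)⁻¹ pays for the
  -- remainder.
  refine ⟨(1 - δ)⁻¹, -Real.log (1 - δ), neg_pos.2 (Real.log_neg hρ (by linarith)),
    by positivity, fun g hg t ht x y => ?_⟩
  set n := ⌊t⌋₊ with hn
  have hnt : (n : ℝ) ≤ t := Nat.floor_le ht
  have hs : ∀ x, ∑ j, NormedSpace.exp (t • G) x j * g j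
      = ∑ k, NormedSpace.exp ((n : ℝ) • G) x k *
        ∑ j, NormedSpace.exp ((t - n) • G) k j * g j := by
    intro x
    conv_lhs => rw [show t = n + (t - n) by ring, exp_add_smul]
    simp_rw [Matrix.mul_apply, Finset.sum_mul, Finset.mul_sum]
    rw [Finset.sum_comm]
    simp_rw [mul_assoc]
  rw [hs, hs]
  refine (hnat n _ (fun a b => ?_) x y).trans ?_
  · simpa using abs_sub_le_of_stochastic le_rfl
      (fun i j => hG.exp_nonneg (sub_nonneg.2 hnt) i j) (hG.sum_exp (t - n)) hg a b
  · have h1 : (1 - δ) ^ n = Real.exp (Real.log (1 - δ) * n) := by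
      rw [mul_comm, Real.exp_nat_mul, Real.exp_log hρ]
    have h2 : (1 - δ)⁻¹ = Real.exp (-Real.log (1 - δ)) := by rw [Real.exp_neg, Real.exp_log hρ]
    rw [h1, h2, ← Real.exp_add, Real.exp_le_exp]
    have h3 : Real.log (1 - δ) < 0 := Real.log_neg hρ (by linarith)
    have h4 : t < n + 1 := Nat.lt_floor_add_one t
    nlinarith

end MatrixExponential

/-! ### Estimates for the occupation of fast states and for the difference of two semigroups -/

/-- Weights of total mass zero do not see constants, so h may be replaced by h - h b. Decay of
oscillations thus becomes decay of the defect. -/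
theorem abs_sum_mul_le_of_sum_eq_zero {T : Type*} [Fintype T] {r h : T → ℝ} {D : ℝ}
    (hr : ∑ a, r a = 0) (hh : ∀ a b, |h a - h b| ≤ D) :
    |∑ a, r a * h a| ≤ (∑ a, |r a|) * D := by
  rcases isEmpty_or_nonempty T with hT | ⟨⟨b⟩⟩
  · simp
  · have h1 : ∑ a, r a * h a = ∑ a, r a * (h a - h b) := by
      simp_rw [mul_sub, Finset.sum_sub_distrib, ← Finset.sum_mul, hr, zero_mul, sub_zero]
    rw [h1, Finset.sum_mul]
    refine (Finset.abs_sum_le_sum_abs _ _).trans (Finset.sum_le_sum fun a _ => ?_)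
    rw [abs_mul]
    exact mul_le_mul_of_nonneg_left (hh a b) (abs_nonneg _)

/-- A chain started outside `F` has, at any time, at most mass `z a` at `a ∈ F`, if `z` is a
supersolution of the balance equations on `F` with immigration at rate `C`. -/
theorem IsRateMatrix.exp_le_of_supersolution {S : Type*} [Fintype S] [DecidableEq S]
    {G : Matrix S S ℝ} (hG : IsRateMatrix G) (F : S → Prop) [DecidablePred F] {z : S → ℝ} {C : ℝ}
    (hz : ∀ k, 0 ≤ z k) (hC : ∀ k a, ¬ F k → F a → G k a ≤ C)
    (hzC : ∀ a, F a → ∑ k, (if F k then z k * G k a else 0) ≤ -C)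
    {i a : S} (hi : ¬ F i) (ha : F a) {t : ℝ} (ht : 0 ≤ t) :
    NormedSpace.exp (t • G) i a ≤ z a := by
  -- The comparison principle is applied to z minus the occupation probabilities, cut off outside F.
  -- Mass enters F from outside at rate at most C, since the total mass is one, and `hzC` absorbs
  -- this inflow.
  set GF : Matrix S S ℝ := fun k j => if F k ∧ F j then G k j else 0 with hGF
  set v : ℝ → S → ℝ := fun s j => if F j then z j - NormedSpace.exp (s • G) i j else 0 with hv
  set v' : ℝ → S → ℝ := fun s j =>
    if F j then -∑ k, NormedSpace.exp (s • G) i k * G k j else 0 with hv'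
  have h := nonneg_of_deriv_ge_vecMul (G := GF) (v := v) (v' := v') ?_ ?_ ?_ ?_ ht a
  · simpa [hv, ha] using h
  · intro k j hkj
    simp only [hGF]
    split_ifs
    · exact hG.nonneg k j hkj
    · exact le_rfl
  · intro s j
    by_cases hj : F j
    · simpa [hv, hv', hj] using (hasDerivAt_exp_smul_apply G s i j).const_sub (z j)
    · simpa [hv, hv', hj] using hasDerivAt_const s (0 : ℝ)
  · intro s hs j
    by_cases hj : F j
    · simp only [hv, hv', hGF, hj, if_true, and_true]
      rw [le_neg_iff_add_nonpos_right, ← Finset.sum_add_distrib]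
      have h1 : ∀ k, (if F k then z k - NormedSpace.exp (s • G) i k else 0) *
          (if F k then G k j else 0) + NormedSpace.exp (s • G) i k * G k j
          ≤ (if F k then z k * G k j else 0) + NormedSpace.exp (s • G) i k * C := by
        intro k
        have h0 := hG.exp_nonneg hs i k
        by_cases hk : F k
        · simp only [hk, if_true]
          have hCn : 0 ≤ C := (hG.nonneg i j (fun h => hi (h ▸ hj))).trans (hC i j hi hj)
          nlinarith [mul_nonneg h0 hCn]
        · simp only [hk, if_false]
          nlinarith [mul_le_mul_of_nonneg_left (hC k j hk hj) h0]
      refine (Finset.sum_le_sum fun k _ => h1 k).trans ?_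
      rw [Finset.sum_add_distrib, ← Finset.sum_mul, hG.sum_exp]
      linarith [hzC j hj]
    · simp [hv, hv', hGF, hj]
  · intro j
    by_cases hj : F j
    · have : i ≠ j := fun h => hi (h ▸ hj)
      simpa [hv, hj, Matrix.one_apply, this] using hz j
    · simp [hv, hj]

/-- Comparison, uniform in time, of the chain with rate matrix `G`, where `G k j = d k * M' k j`,
with a reduced chain with rate matrix `H`, in terms of the distance `ε` of `M'` from a matrix `M`
and an upper bound `δ` for the inverses of the fast rates `d k`. The rows of `E` are the hitting
distributions of the slow states for `M`. -/
theorem abs_exp_sub_exp_reduced_le {S B : Type*} [Fintype S] [DecidableEq S] [Fintype B]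
    [DecidableEq B] {G M M' : Matrix S S ℝ} {H : Matrix B B ℝ} {E : Matrix S B ℝ}
    {d y : S → ℝ} {ι : B → S} {ε δ K K₁ α : ℝ}
    (hG : IsRateMatrix G) (hd : ∀ k, 0 < d k) (hGM : ∀ k j, G k j = d k * M' k j)
    (hM : ∀ k, ∑ j, M k j = 0) (hε : ∀ k, ∑ j, |M' k j - M k j| ≤ ε)
    (hδ0 : 0 ≤ δ) (hδ : ∀ k, k ∉ Set.range ι → 1 / d k ≤ δ) (hd1 : ∀ b, d (ι b) = 1)
    (hE0 : ∀ k b, 0 ≤ E k b) (hE1 : ∀ k, ∑ b, E k b = 1)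
    (hEι : ∀ b c, E (ι b) c = (1 : Matrix B B ℝ) b c)
    (hMEslow : ∀ b c, ∑ j, M (ι b) j * E j c = H b c)
    (hMEfast : ∀ k, k ∉ Set.range ι → ∀ c, ∑ j, M k j * E j c = 0)
    (hH : IsRateMatrix H) (hK₁ : ∀ b, ∑ c, |H b c| ≤ K₁) (hK₁0 : 0 ≤ K₁) (hα : 0 < α) (hK : 0 ≤ K)
    {i j : B}
    (hdecay : ∀ t : ℝ, 0 ≤ t → ∀ x y, |NormedSpace.exp (t • H) x j - NormedSpace.exp (t • H) y j|
      ≤ K * Real.exp (-α * t))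
    (hy : ∀ t : ℝ, 0 ≤ t → ∀ k, NormedSpace.exp (t • G) (ι i) k * d k ≤ y k)
    {t : ℝ} (ht : 0 ≤ t) :
    |NormedSpace.exp (t • G) (ι i) (ι j) - NormedSpace.exp (t • H) i j|
      ≤ (∑ k, y k) * (ε + K₁ * δ) * (K / α) + (∑ k, y k) * δ := by
  have hy0 : ∀ k, 0 ≤ y k := fun k =>
    (mul_nonneg (hG.exp_nonneg le_rfl (ι i) k) (hd k).le).trans (hy 0 le_rfl k)
  have hM' : ∀ k, ∑ j, M' k j = 0 := fun k => by
    have h := hG.row_sum k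
    simp_rw [hGM, ← Finset.mul_sum] at h
    exact (mul_eq_zero.1 h).resolve_left (hd k).ne'
  have hε0 : 0 ≤ ε := (Finset.sum_nonneg fun _ _ => abs_nonneg _).trans (hε (ι i))
  set Y := ∑ k, y k with hY
  have hY0 : 0 ≤ Y := Finset.sum_nonneg fun k _ => hy0 k
  -- the extended solution of the reduced backward equation and its derivative
  set U : ℝ → S → ℝ := fun s k => ∑ c, E k c * NormedSpace.exp (s • H) c j with hU
  set U' : ℝ → S → ℝ := fun s k =>
    ∑ c, E k c * ∑ e, H c e * NormedSpace.exp (s • H) e j with hU'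
  have hUd : ∀ s k, HasDerivAt (fun r => U r k) (U' s k) s := fun s k =>
    HasDerivAt.fun_sum fun c _ => (hasDerivAt_exp_smul_apply_left H s c j).const_mul (E k c)
  have hUosc : ∀ s, 0 ≤ s → ∀ x y, |U s x - U s y| ≤ K * Real.exp (-α * s) := fun s hs x y => by
    simpa using abs_sub_le_of_stochastic le_rfl hE0 hE1 (hdecay s hs) x y
  have hU'b : ∀ s, 0 ≤ s → ∀ k, |U' s k| ≤ K₁ * (K * Real.exp (-α * s)) := by
    intro s hs k
    calc |U' s k| ≤ ∑ c, |E k c * ∑ e, H c e * NormedSpace.exp (s • H) e j| :=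
          Finset.abs_sum_le_sum_abs _ _
      _ ≤ ∑ c, E k c * (K₁ * (K * Real.exp (-α * s))) := Finset.sum_le_sum fun c _ => by
          rw [abs_mul, abs_of_nonneg (hE0 k c)]
          refine mul_le_mul_of_nonneg_left ?_ (hE0 k c)
          exact (abs_sum_mul_le_of_sum_eq_zero (hH.row_sum c) (hdecay s hs)).trans
            (mul_le_mul_of_nonneg_right (hK₁ c) (by positivity))
      _ = _ := by rw [← Finset.sum_mul, hE1, one_mul]
  have hMU : ∀ s k, ∑ l, M k l * U s l
      = ∑ c, (∑ l, M k l * E l c) * NormedSpace.exp (s • H) c j := by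
    intro s k
    simp_rw [hU, Finset.mul_sum, Finset.sum_mul]
    rw [Finset.sum_comm]
    simp_rw [mul_assoc]
  -- the defect
  have hdef : ∀ s, 0 ≤ s → ∀ k, |U' s k - ∑ l, G k l * U s l|
      ≤ d k * (ε + K₁ * δ) * (K * Real.exp (-α * s)) := by
    intro s hs k
    have hD : 0 ≤ K * Real.exp (-α * s) := by positivity
    have h1 : ∑ l, G k l * U s l
        = d k * ∑ l, (M' k l - M k l) * U s l + d k * ∑ l, M k l * U s l := by
      rw [← mul_add, ← Finset.sum_add_distrib, Finset.mul_sum]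
      refine Finset.sum_congr rfl fun l _ => ?_
      rw [hGM]; ring
    -- The rows of M' - M sum to zero, so only the oscillation of U enters.
    have h2 : |d k * ∑ l, (M' k l - M k l) * U s l| ≤ d k * ε * (K * Real.exp (-α * s)) := by
      rw [abs_mul, abs_of_pos (hd k), mul_assoc]
      refine mul_le_mul_of_nonneg_left ?_ (hd k).le
      refine (abs_sum_mul_le_of_sum_eq_zero ?_ (hUosc s hs)).trans
        (mul_le_mul_of_nonneg_right (hε k) hD)
      rw [Finset.sum_sub_distrib, hM, hM', sub_zero]
    -- In a slow row ME = H, and the difference vanishes. In a fast row ME = 0, which leaves U'; it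
    -- is bounded without a factor d k, so 1 ≤ δ * d k supplies one at the price of δ.
    have h3 : |U' s k - d k * ∑ l, M k l * U s l|
        ≤ d k * (K₁ * δ) * (K * Real.exp (-α * s)) := by
      rw [hMU]
      by_cases hk : k ∈ Set.range ι
      · obtain ⟨b, rfl⟩ := hk
        have : U' s (ι b) - d (ι b) * ∑ c, (∑ l, M (ι b) l * E l c) * NormedSpace.exp (s • H) c j
            = 0 := by
          simp [hU', hEι, hMEslow, hd1, Matrix.one_apply]
        rw [this, abs_zero]
        have := (hd (ι b)).le
        positivity
      · simp_rw [hMEfast k hk, zero_mul, Finset.sum_const_zero, mul_zero, sub_zero]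
        refine (hU'b s hs k).trans (mul_le_mul_of_nonneg_right ?_ hD)
        have h4 : 1 ≤ δ * d k := (div_le_iff₀ (hd k)).1 (hδ k hk)
        nlinarith
    rw [h1, show U' s k - (d k * ∑ l, (M' k l - M k l) * U s l + d k * ∑ l, M k l * U s l)
      = (U' s k - d k * ∑ l, M k l * U s l) - d k * ∑ l, (M' k l - M k l) * U s l by ring]
    refine (abs_sub _ _).trans ?_
    nlinarith
  -- interpolation between the two semigroups
  set f : ℝ → ℝ := fun s => ∑ k, NormedSpace.exp ((t - s) • G) (ι i) k * U s k with hf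
  have hfd : ∀ s, HasDerivAt f
      (∑ k, NormedSpace.exp ((t - s) • G) (ι i) k * (U' s k - ∑ l, G k l * U s l)) s := by
    intro s
    have hexp : ∀ k, HasDerivAt (fun s : ℝ => NormedSpace.exp ((t - s) • G) (ι i) k)
        (-(∑ l, NormedSpace.exp ((t - s) • G) (ι i) l * G l k)) s := fun k => by
      have := (hasDerivAt_exp_smul_apply G (t - s) (ι i) k).comp s
        ((hasDerivAt_id s).const_sub t)
      simpa [Function.comp_def] using this
    refine (HasDerivAt.fun_sum (u := Finset.univ)
      fun k _ => (hexp k).fun_mul (hUd s k)).congr_deriv ?_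
    simp_rw [mul_sub, neg_mul, Finset.sum_add_distrib, Finset.sum_sub_distrib,
      Finset.sum_neg_distrib]
    rw [neg_add_eq_sub]
    congr 1
    simp_rw [Finset.sum_mul, Finset.mul_sum]
    rw [Finset.sum_comm]
    simp_rw [mul_assoc]
  have hbd : ∀ s ∈ Set.Ico 0 t,
      ‖∑ k, NormedSpace.exp ((t - s) • G) (ι i) k * (U' s k - ∑ l, G k l * U s l)‖
        ≤ Y * (ε + K₁ * δ) * (K * Real.exp (-α * s)) := by
    intro s hs
    rw [Real.norm_eq_abs, hY, Finset.sum_mul, Finset.sum_mul]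
    refine (Finset.abs_sum_le_sum_abs _ _).trans (Finset.sum_le_sum fun k _ => ?_)
    have h0 := hG.exp_nonneg (sub_nonneg.2 hs.2.le) (ι i) k
    rw [abs_mul, abs_of_nonneg h0]
    refine (mul_le_mul_of_nonneg_left (hdef s hs.1 k) h0).trans ?_
    rw [show NormedSpace.exp ((t - s) • G) (ι i) k * (d k * (ε + K₁ * δ) * (K * Real.exp (-α * s)))
      = NormedSpace.exp ((t - s) • G) (ι i) k * d k * (ε + K₁ * δ) * (K * Real.exp (-α * s)) by ring]
    refine mul_le_mul_of_nonneg_right ?_ (by positivity)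
    exact mul_le_mul_of_nonneg_right (hy _ (sub_nonneg.2 hs.2.le) k) (by positivity)
  -- An antiderivative of the bound on |f'|. It stays below its limit at infinity, which is why the
  -- final estimate does not depend on t.
  have hbound : ∀ s : ℝ, HasDerivAt
      (fun s => Y * (ε + K₁ * δ) * (K / α) * (1 - Real.exp (-α * s)))
      (Y * (ε + K₁ * δ) * (K * Real.exp (-α * s))) s := by
    intro s
    have h1 : HasDerivAt (fun s : ℝ => Real.exp (-α * s)) (Real.exp (-α * s) * (-α)) s := by
      simpa using ((hasDerivAt_id s).const_mul (-α)).exp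
    refine ((h1.const_sub 1).const_mul _).congr_deriv ?_
    field_simp
  have hfence := image_norm_le_of_norm_deriv_right_le_deriv_boundary (f := fun s => f s - f 0)
    (a := 0) (b := t)
    (fun s _ => ((hfd s).sub_const _).continuousAt.continuousWithinAt)
    (fun s _ => ((hfd s).sub_const _).hasDerivWithinAt) (by simp) hbound hbd
    (Set.right_mem_Icc.2 ht)
  have hft : f t = NormedSpace.exp (t • H) i j := by
    simp [hf, hU, hEι, Matrix.one_apply]
  -- On slow states E is the identity, so only fast states contribute; each carries mass at most y k
  -- / d k ≤ y k * δ.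
  have hf0 : |NormedSpace.exp (t • G) (ι i) (ι j) - f 0| ≤ Y * δ := by
    have h1 : f 0 = ∑ k, NormedSpace.exp (t • G) (ι i) k * E k j := by
      simp [hf, hU, Matrix.one_apply]
    have h2 : NormedSpace.exp (t • G) (ι i) (ι j)
        = ∑ k, NormedSpace.exp (t • G) (ι i) k * (if k = ι j then 1 else 0) := by simp
    rw [h1, h2, ← Finset.sum_sub_distrib, hY, Finset.sum_mul]
    refine (Finset.abs_sum_le_sum_abs _ _).trans (Finset.sum_le_sum fun k _ => ?_)
    have h0 := hG.exp_nonneg ht (ι i) k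
    by_cases hk : k ∈ Set.range ι
    · obtain ⟨b, rfl⟩ := hk
      have h3 : (if ι b = ι j then (1 : ℝ) else 0) = E (ι b) j := by
        rw [hEι, Matrix.one_apply]
        by_cases hb : b = j
        · simp [hb]
        · have : ι b ≠ ι j := fun h => hb (by
            have h4 := hEι b j
            rw [h, hEι, Matrix.one_apply_eq, Matrix.one_apply_ne hb] at h4
            exact absurd h4 one_ne_zero)
          simp [hb, this]
      rw [h3, sub_self, abs_zero]
      exact mul_nonneg (hy0 _) hδ0
    · have h3 : k ≠ ι j := fun h => hk ⟨j, h.symm⟩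
      have h4 : E k j ≤ 1 := by
        rw [← hE1 k]
        exact Finset.single_le_sum (fun b _ => hE0 k b) (Finset.mem_univ j)
      rw [if_neg h3, mul_zero, zero_sub, abs_neg, abs_of_nonneg (mul_nonneg h0 (hE0 k j))]
      have h5 : 1 ≤ δ * d k := (div_le_iff₀ (hd k)).1 (hδ k hk)
      calc NormedSpace.exp (t • G) (ι i) k * E k j
          ≤ NormedSpace.exp (t • G) (ι i) k * 1 := mul_le_mul_of_nonneg_left h4 h0
        _ ≤ NormedSpace.exp (t • G) (ι i) k * (δ * d k) := mul_le_mul_of_nonneg_left h5 h0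
        _ = NormedSpace.exp (t • G) (ι i) k * d k * δ := by ring
        _ ≤ y k * δ := mul_le_mul_of_nonneg_right (hy t ht k) hδ0
  rw [Real.norm_eq_abs, hft] at hfence
  have hle : Y * (ε + K₁ * δ) * (K / α) * (1 - Real.exp (-α * t))
      ≤ Y * (ε + K₁ * δ) * (K / α) := by
    refine mul_le_of_le_one_right (by positivity) ?_
    linarith [Real.exp_pos (-α * t)]
  calc |NormedSpace.exp (t • G) (ι i) (ι j) - NormedSpace.exp (t • H) i j|
      ≤ |NormedSpace.exp (t • G) (ι i) (ι j) - f 0| + |f 0 - NormedSpace.exp (t • H) i j| :=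
        abs_sub_le _ _ _
    _ ≤ Y * δ + Y * (ε + K₁ * δ) * (K / α) := by
        rw [abs_sub_comm (f 0)]
        exact add_le_add hf0 (hfence.trans hle)
    _ = _ := add_comm _ _

/-! ### Minimum principle and reachability for discrete chains -/

/-- A minimum principle: a function superharmonic on `F` and nonnegative off `F` is nonnegative,
if `F` can be left from each of its points. -/
theorem nonneg_of_superharmonic {S : Type*} [Fintype S] {W : Matrix S S ℝ} {F : S → Prop}
    (hW : ∀ a, F a → ∀ j, 0 ≤ W a j) (hsum : ∀ a, F a → ∑ j, W a j = 1)
    (hreach : ∀ a, F a → ∃ b, ¬ F b ∧ Relation.ReflTransGen (fun p q => W p q ≠ 0) a b)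
    {x : S → ℝ} (hx : ∀ a, F a → ∑ j, W a j * x j ≤ x a) (hx0 : ∀ b, ¬ F b → 0 ≤ x b) (k : S) :
    0 ≤ x k := by
  have : Nonempty S := ⟨k⟩
  obtain ⟨m, hm⟩ := Finite.exists_min x
  suffices 0 ≤ x m from this.trans (hm k)
  by_contra hneg
  have hF : ∀ j, x j = x m → F j := fun j hj => by
    by_contra hFj
    exact hneg (hj ▸ hx0 j hFj)
  obtain ⟨b, hb, hpath⟩ := hreach m (hF m rfl)
  refine hb (hF b ?_)
  clear hb
  -- A negative minimum spreads along the path: where it is attained, superharmonicity forces it at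
  -- every successor of nonzero weight. It would thus reach b, outside F.
  induction hpath with
  | refl => rfl
  | @tail p q _ hpq ih =>
    have hFp := hF p ih
    have h0 : ∀ j ∈ Finset.univ, 0 ≤ W p j * (x j - x m) := fun j _ =>
      mul_nonneg (hW p hFp j) (sub_nonneg.2 (hm j))
    have h1 : ∑ j, W p j * (x j - x m) = 0 := by
      refine le_antisymm ?_ (Finset.sum_nonneg h0)
      simp_rw [mul_sub, Finset.sum_sub_distrib, ← Finset.sum_mul, hsum p hFp]
      linarith [hx p hFp]
    have h2 := (Finset.sum_eq_zero_iff_of_nonneg h0).1 h1 q (Finset.mem_univ q)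
    exact sub_eq_zero.1 ((mul_eq_zero.1 h2).resolve_left hpq)

section DiscreteChain

variable {S : Type*} {Ω : Type*} [MeasurableSpace Ω] {W : Matrix S S ℝ} {i : S} {P : Measure Ω}
  {η : ℕ → Ω → S}

theorem IsDiscreteMarkovChain.reachable_of_ne_zero (h : IsDiscreteMarkovChain W i P η) (n : ℕ)
    (s : ℕ → S) (hs : P.real {ω | ∀ k ≤ n, η k ω = s k} ≠ 0) :
    Relation.ReflTransGen (fun p q => W p q ≠ 0) i (s n) := by
  induction n with
  | zero =>
    have := h.isProbabilityMeasure
    have h0 : s 0 = i := by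
      by_contra hne
      apply hs
      have hsub : {ω | ∀ k ≤ 0, η k ω = s k} ⊆ {ω | η 0 ω = i}ᶜ := fun ω hω => by
        simp only [Set.mem_ofPred_eq, Set.mem_compl_iff] at hω ⊢
        rw [hω 0 le_rfl]
        exact hne
      have hc : P.real {ω | η 0 ω = i}ᶜ = 0 := by
        rw [probReal_compl_eq_one_sub (h.measurableSet_eq 0 i), h.start, sub_self]
      exact le_antisymm ((measureReal_mono hsub).trans hc.le) measureReal_nonneg
    rw [h0]
  | succ n ih =>
    rw [h.markov] at hs
    exact (ih (left_ne_zero_of_mul hs)).tail (right_ne_zero_of_mul hs)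

theorem IsDiscreteMarkovChain.exists_reachable [Finite S] (h : IsDiscreteMarkovChain W i P η)
    {p : S → Prop} (hp : P {ω | ∃ n, p (η n ω)} = 1) :
    ∃ b, p b ∧ Relation.ReflTransGen (fun p q => W p q ≠ 0) i b := by
  have := h.isProbabilityMeasure
  by_contra hcon
  push Not at hcon
  -- Finite words keep the union countable. Each cylinder ending in p is null, since positive
  -- probability would make its end point reachable.
  have hnull : P (⋃ n : ℕ, ⋃ w : Fin (n + 1) → S, ⋃ _ : p (w (Fin.last n)),
      {ω | ∀ k ≤ n, η k ω = w (Fin.ofNat (n + 1) k)}) = 0 := by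
    refine measure_iUnion_null fun n => measure_iUnion_null fun w => measure_iUnion_null fun hw => ?_
    by_contra hne
    refine hcon _ hw ?_
    have h1 := h.reachable_of_ne_zero n (fun k => w (Fin.ofNat (n + 1) k)) fun h0 => hne
      ((measureReal_eq_zero_iff).1 h0)
    have h2 : Fin.ofNat (n + 1) n = Fin.last n := by ext; simp
    simpa [h2] using h1
  have : P {ω | ∃ n, p (η n ω)} = 0 := by
    refine measure_mono_null (fun ω hω => ?_) hnull
    obtain ⟨n, hn⟩ := hω
    simp only [Set.mem_iUnion, Set.mem_ofPred_eq]
    refine ⟨n, fun k => η k ω, by simpa using hn, fun k hk => ?_⟩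
    simp [Nat.mod_eq_of_lt (Nat.lt_succ_of_le hk)]
  rw [hp] at this
  exact one_ne_zero this

end DiscreteChain

/-! ### Fast and slow states, and limits of the rescaled rates -/

section Limits

variable {S : Type*} {Q : ℝ → Matrix S S ℝ}

theorem not_isFast_of_isSlow {i : S} (hi : IsSlow Q i) : ¬ IsFast Q i := fun hf =>
  let ⟨_, hc⟩ := hi
  not_tendsto_nhds_of_tendsto_atTop hf _ hc

open Classical in
/-- The time scale of a state: its total rate if it is fast, and one if it is slow. -/
noncomputable def timeScale (Q : ℝ → Matrix S S ℝ) (l : ℝ) (i : S) : ℝ :=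
  if IsFast Q i then -Q l i i else 1

/-- The rate matrix after rescaling time in the fast states. -/
noncomputable def scaledRate (Q : ℝ → Matrix S S ℝ) (l : ℝ) : Matrix S S ℝ :=
  fun i j => Q l i j / timeScale Q l i

theorem eventually_timeScale_pos [Finite S] (Q : ℝ → Matrix S S ℝ) :
    ∀ᶠ l in atTop, ∀ i, 0 < timeScale Q l i := by
  rw [eventually_all]
  intro i
  by_cases hi : IsFast Q i
  · simpa [timeScale, hi] using hi.eventually_gt_atTop 0
  · simp [timeScale, hi]

variable [DecidableEq S]

theorem limitJump_self (Q : ℝ → Matrix S S ℝ) (i : S) : limitJump Q i i = 0 :=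
  Tendsto.limUnder_eq (by simp [jumpMatrix])

open Classical in
/-- The limit of the rescaled rate matrices. -/
noncomputable def limitScaledRate (Q : ℝ → Matrix S S ℝ) : Matrix S S ℝ :=
  fun i j => if IsFast Q i then limitJump Q i j - (1 : Matrix S S ℝ) i j else limitRate Q i j

theorem limitScaledRate_of_isFast {i : S} (hi : IsFast Q i) (j : S) :
    limitScaledRate Q i j = limitJump Q i j - (1 : Matrix S S ℝ) i j := by
  simp [limitScaledRate, hi]

theorem limitScaledRate_of_isSlow {i : S} (hi : IsSlow Q i) (j : S) :
    limitScaledRate Q i j = limitRate Q i j := by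
  simp [limitScaledRate, not_isFast_of_isSlow hi]

variable [Fintype S]

theorem IsRateMatrix.neg_diag_eq {G : Matrix S S ℝ} (hG : IsRateMatrix G) (i : S) :
    -G i i = ∑ j ∈ Finset.univ.erase i, G i j := by
  have := hG.row_sum i
  rw [← Finset.add_sum_erase _ _ (Finset.mem_univ i)] at this
  linarith

theorem IsRateMatrix.le_neg_diag {G : Matrix S S ℝ} (hG : IsRateMatrix G) {i j : S} (hij : i ≠ j) :
    G i j ≤ -G i i := by
  rw [hG.neg_diag_eq]
  exact Finset.single_le_sum (fun k hk => hG.nonneg i k (Finset.ne_of_mem_erase hk).symm)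
    (Finset.mem_erase.2 ⟨hij.symm, Finset.mem_univ j⟩)

theorem IsTwoTimeScale.eventually_isRateMatrix (h : IsTwoTimeScale Q) :
    ∀ᶠ l in atTop, IsRateMatrix (Q l) :=
  (eventually_gt_atTop 0).mono h.isRateMatrix

/-- The total rate is a finite sum of nonnegative rates with limits in [0,∞]: either all limits are
finite, or one infinite limit carries the sum to infinity. -/
theorem IsTwoTimeScale.isSlow_or_isFast (h : IsTwoTimeScale Q) (i : S) :
    IsSlow Q i ∨ IsFast Q i := by
  by_cases hfin : ∀ j, i ≠ j → ∃ c : ℝ, Tendsto (fun l => Q l i j) atTop (𝓝 c)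
  · left
    choose! c hc using hfin
    refine ⟨∑ j ∈ Finset.univ.erase i, c j, ?_⟩
    refine (tendsto_finsetSum _ fun j hj =>
      hc j (Finset.ne_of_mem_erase hj).symm).congr' ?_
    filter_upwards [h.eventually_isRateMatrix] with l hl
    exact (hl.neg_diag_eq i).symm
  · right
    push Not at hfin
    obtain ⟨j, hij, hj⟩ := hfin
    have hinf : Tendsto (fun l => Q l i j) atTop atTop :=
      (h.tendsto_rate i j hij).resolve_left fun ⟨c, hc⟩ => hj c hc
    refine tendsto_atTop_mono' _ ?_ hinf
    filter_upwards [h.eventually_isRateMatrix] with l hl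
    exact hl.le_neg_diag hij

theorem IsTwoTimeScale.not_isFast_iff (h : IsTwoTimeScale Q) {i : S} :
    ¬ IsFast Q i ↔ IsSlow Q i :=
  ⟨(h.isSlow_or_isFast i).resolve_right, not_isFast_of_isSlow⟩

theorem IsTwoTimeScale.sum_eq (h : IsTwoTimeScale Q) (f : S → ℝ) :
    ∑ j, f j = ∑ a : FastState Q, f a + ∑ b : SlowState Q, f b := by
  have hbij : Function.Bijective
      (Sum.elim Subtype.val Subtype.val : FastState Q ⊕ SlowState Q → S) := by
    constructor
    · rintro (⟨a, ha⟩ | ⟨a, ha⟩) (⟨b, hb⟩ | ⟨b, hb⟩) hab <;>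
        simp only [Sum.elim_inl, Sum.elim_inr] at hab <;> subst hab
      · rfl
      · exact absurd ha (not_isFast_of_isSlow hb)
      · exact absurd hb (not_isFast_of_isSlow ha)
      · rfl
    · intro j
      rcases h.isSlow_or_isFast j with hj | hj
      · exact ⟨Sum.inr ⟨j, hj⟩, rfl⟩
      · exact ⟨Sum.inl ⟨j, hj⟩, rfl⟩
  rw [← Fintype.sum_bijective _ hbij (fun x => f (Sum.elim Subtype.val Subtype.val x)) f
    (fun _ => rfl), Fintype.sum_sum_type]
  rfl

theorem IsTwoTimeScale.tendsto_limitRate (h : IsTwoTimeScale Q) {i : S} (hi : IsSlow Q i) (j : S) :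
    Tendsto (fun l => Q l i j) atTop (𝓝 (limitRate Q i j)) := by
  suffices ∃ c : ℝ, Tendsto (fun l => Q l i j) atTop (𝓝 c) from tendsto_nhds_limUnder this
  by_cases hij : i = j
  · subst hij
    obtain ⟨c, hc⟩ := hi
    exact ⟨-c, by simpa using hc.neg⟩
  · refine (h.tendsto_rate i j hij).resolve_right fun hinf => not_isFast_of_isSlow hi ?_
    refine tendsto_atTop_mono' _ ?_ hinf
    filter_upwards [h.eventually_isRateMatrix] with l hl
    exact hl.le_neg_diag hij

theorem IsTwoTimeScale.tendsto_limitJump (h : IsTwoTimeScale Q) (i j : S) :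
    Tendsto (fun l => jumpMatrix (Q l) i j) atTop (𝓝 (limitJump Q i j)) := by
  suffices ∃ c : ℝ, Tendsto (fun l => jumpMatrix (Q l) i j) atTop (𝓝 c) from
    tendsto_nhds_limUnder this
  by_cases hij : i = j
  · exact ⟨0, by simp [jumpMatrix, hij]⟩
  · exact h.tendsto_jump i j hij

theorem IsTwoTimeScale.tendsto_scaledRate (h : IsTwoTimeScale Q) (i j : S) :
    Tendsto (fun l => scaledRate Q l i j) atTop (𝓝 (limitScaledRate Q i j)) := by
  by_cases hi : IsFast Q i
  · by_cases hij : i = j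
    · subst hij
      simp only [scaledRate, limitScaledRate, timeScale, hi, if_true, limitJump_self,
        Matrix.one_apply_eq, zero_sub]
      refine tendsto_const_nhds.congr' ?_
      filter_upwards [hi.eventually_gt_atTop 0] with l hl
      rw [div_neg, div_self (by linarith)]
    · simp only [scaledRate, limitScaledRate, timeScale, hi, if_true, Matrix.one_apply_ne hij,
        sub_zero]
      simpa [jumpMatrix, hij] using h.tendsto_limitJump i j
  · simpa [scaledRate, limitScaledRate, timeScale, hi] using
      h.tendsto_limitRate (h.not_isFast_iff.1 hi) j

theorem IsTwoTimeScale.limitScaledRate_isRateMatrix (h : IsTwoTimeScale Q) :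
    IsRateMatrix (limitScaledRate Q) where
  nonneg i j hij := by
    refine ge_of_tendsto (h.tendsto_scaledRate i j) ?_
    filter_upwards [h.eventually_isRateMatrix, eventually_timeScale_pos Q] with l hl hpos
    exact div_nonneg (hl.nonneg i j hij) (hpos i).le
  row_sum i := by
    refine tendsto_nhds_unique (tendsto_finsetSum Finset.univ fun j _ => h.tendsto_scaledRate i j) ?_
    refine tendsto_const_nhds.congr' ?_
    filter_upwards [h.eventually_isRateMatrix] with l hl
    simp_rw [scaledRate, ← Finset.sum_div, hl.row_sum, zero_div]

theorem IsTwoTimeScale.limitJump_nonneg (h : IsTwoTimeScale Q) {a : S} (ha : IsFast Q a) (j : S) :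
    0 ≤ limitJump Q a j := by
  by_cases haj : a = j
  · rw [← haj, limitJump_self]
  · have := h.limitScaledRate_isRateMatrix.nonneg a j haj
    rwa [limitScaledRate_of_isFast ha, Matrix.one_apply_ne haj, sub_zero] at this

theorem IsTwoTimeScale.sum_limitJump (h : IsTwoTimeScale Q) {a : S} (ha : IsFast Q a) :
    ∑ j, limitJump Q a j = 1 := by
  have := h.limitScaledRate_isRateMatrix.row_sum a
  simp_rw [limitScaledRate_of_isFast ha, Finset.sum_sub_distrib] at this
  simpa [Matrix.one_apply, sub_eq_zero] using this

end Limits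

/-! ### Hitting distributions, the reduced rate matrix and uniform convergence -/

section Reduction

variable {S : Type*} [DecidableEq S] {Q : ℝ → Matrix S S ℝ}

/-- The transition probabilities between fast states of the limit jump chain. -/
noncomputable def fastJump (Q : ℝ → Matrix S S ℝ) : Matrix (FastState Q) (FastState Q) ℝ :=
  fun a b => limitJump Q a b

/-- The transition probabilities from fast to slow states of the limit jump chain. -/
noncomputable def fastSlowJump (Q : ℝ → Matrix S S ℝ) : Matrix (FastState Q) (SlowState Q) ℝ :=
  fun a b => limitJump Q a b

variable [Fintype S]

/-- Extended by zero to the slow states, x is superharmonic on the fast ones, and `hits_slow`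
provides the exits that the minimum principle needs. Both invertibility of 1 - Ω_AA and positivity
of its inverse follow. -/
theorem IsTwoTimeScale.nonneg_of_sub_fastJump_mulVec_nonneg (h : IsTwoTimeScale Q)
    {x : FastState Q → ℝ} (hx : ∀ a, 0 ≤ (1 - fastJump Q).mulVec x a) (a : FastState Q) :
    0 ≤ x a := by
  classical
  set x' : S → ℝ := fun k => if hk : IsFast Q k then x ⟨k, hk⟩ else 0 with hx'
  have key := nonneg_of_superharmonic (W := limitJump Q) (F := IsFast Q) (x := x')
    (fun a ha => h.limitJump_nonneg ha) (fun a ha => h.sum_limitJump ha) ?_ ?_ ?_ a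
  · simpa [hx', a.2] using key
  · intro a ha
    obtain ⟨Ω, _, P, η, hη, hP⟩ := h.hits_slow a ha
    obtain ⟨b, hb, hab⟩ := hη.exists_reachable (p := IsSlow Q) hP
    exact ⟨b, not_isFast_of_isSlow hb, hab⟩
  · intro a ha
    have h1 := hx ⟨a, ha⟩
    rw [Matrix.sub_mulVec, Matrix.one_mulVec, Pi.sub_apply, sub_nonneg] at h1
    rw [h.sum_eq]
    have h2 : ∀ c : SlowState Q, x' c = 0 := fun c => by
      simp [hx', not_isFast_of_isSlow c.2]
    have h3 : ∀ c : FastState Q, x' c = x c := fun c => by simp [hx', c.2]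
    simp_rw [h2, h3, mul_zero, Finset.sum_const_zero, add_zero]
    simpa [hx', ha, Matrix.mulVec, dotProduct, fastJump] using h1
  · intro b hb
    simp [hx', hb]

theorem IsTwoTimeScale.isUnit_det_sub_fastJump (h : IsTwoTimeScale Q) :
    IsUnit (1 - fastJump Q).det := by
  rw [isUnit_iff_ne_zero]
  intro hdet
  obtain ⟨v, hv, hv0⟩ := Matrix.exists_mulVec_eq_zero_iff.2 hdet
  refine hv (funext fun a => le_antisymm ?_ ?_)
  · have := h.nonneg_of_sub_fastJump_mulVec_nonneg (x := -v)
      (fun a => by rw [Matrix.mulVec_neg, hv0]; simp) a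
    simpa using this
  · exact h.nonneg_of_sub_fastJump_mulVec_nonneg (fun a => by rw [hv0]; simp) a

theorem IsTwoTimeScale.inv_sub_fastJump_nonneg (h : IsTwoTimeScale Q) (a c : FastState Q) :
    0 ≤ (1 - fastJump Q)⁻¹ a c := by
  refine h.nonneg_of_sub_fastJump_mulVec_nonneg (x := fun a => (1 - fastJump Q)⁻¹ a c)
    (fun b => ?_) a
  have h1 := congrFun (congrFun (Matrix.mul_nonsing_inv _ h.isUnit_det_sub_fastJump) b) c
  rw [Matrix.mul_apply] at h1
  simp only [Matrix.mulVec, dotProduct]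
  rw [h1, Matrix.one_apply]
  split_ifs <;> norm_num

open Classical in
/-- The distribution of the slow state first visited by the limit jump chain. -/
noncomputable def hittingMatrix (Q : ℝ → Matrix S S ℝ) : Matrix S (SlowState Q) ℝ :=
  fun k c => if hk : IsFast Q k then ((1 - fastJump Q)⁻¹ * fastSlowJump Q) ⟨k, hk⟩ c
    else if k = c then 1 else 0

theorem hittingMatrix_fast (a : FastState Q) (c : SlowState Q) :
    hittingMatrix Q a c = ((1 - fastJump Q)⁻¹ * fastSlowJump Q) a c := by
  simp [hittingMatrix, a.2]

theorem hittingMatrix_slow (b c : SlowState Q) :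
    hittingMatrix Q b c = (1 : Matrix (SlowState Q) (SlowState Q) ℝ) b c := by
  simp [hittingMatrix, not_isFast_of_isSlow b.2, Matrix.one_apply, Subtype.ext_iff]

theorem IsTwoTimeScale.hittingMatrix_nonneg (h : IsTwoTimeScale Q) (k : S) (c : SlowState Q) :
    0 ≤ hittingMatrix Q k c := by
  rcases h.isSlow_or_isFast k with hk | hk
  · rw [show k = ((⟨k, hk⟩ : SlowState Q) : S) from rfl, hittingMatrix_slow, Matrix.one_apply]
    split_ifs <;> norm_num
  · rw [show k = ((⟨k, hk⟩ : FastState Q) : S) from rfl, hittingMatrix_fast, Matrix.mul_apply]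
    exact Finset.sum_nonneg fun a _ => mul_nonneg (h.inv_sub_fastJump_nonneg _ a)
      (h.limitJump_nonneg a.2 c)

theorem IsTwoTimeScale.sum_hittingMatrix (h : IsTwoTimeScale Q) (k : S) :
    ∑ c, hittingMatrix Q k c = 1 := by
  rcases h.isSlow_or_isFast k with hk | hk
  · obtain ⟨b, rfl⟩ : ∃ b : SlowState Q, (b : S) = k := ⟨⟨k, hk⟩, rfl⟩
    simp_rw [hittingMatrix_slow]
    simp [Matrix.one_apply]
  · obtain ⟨a, rfl⟩ : ∃ a : FastState Q, (a : S) = k := ⟨⟨k, hk⟩, rfl⟩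
    simp_rw [hittingMatrix_fast]
    -- The rows of Ω_AA and Ω_AB together sum to one, so Ω_AB 1 = (1 - Ω_AA) 1, and the inverse
    -- cancels.
    have h1 : (fastSlowJump Q).mulVec 1 = (1 - fastJump Q).mulVec 1 := by
      ext a
      have h2 := h.sum_limitJump a.2
      rw [h.sum_eq] at h2
      rw [Matrix.sub_mulVec, Matrix.one_mulVec]
      simp only [Matrix.mulVec, dotProduct, Pi.sub_apply, Pi.one_apply, mul_one, fastSlowJump,
        fastJump]
      linarith
    have h3 : ((1 - fastJump Q)⁻¹ * fastSlowJump Q).mulVec 1 = 1 := by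
      rw [← Matrix.mulVec_mulVec, h1, Matrix.mulVec_mulVec,
        Matrix.nonsing_inv_mul _ h.isUnit_det_sub_fastJump, Matrix.one_mulVec]
    simpa [Matrix.mulVec, dotProduct] using congrFun h3 a

theorem reducedRate_apply (Q : ℝ → Matrix S S ℝ) (b c : SlowState Q) :
    reducedRate Q b c = limitRate Q b c
      + ∑ a : FastState Q, limitRate Q b a * ((1 - fastJump Q)⁻¹ * fastSlowJump Q) a c := by
  let QBB : Matrix (SlowState Q) (SlowState Q) ℝ := fun i j => limitRate Q i j
  let QBA : Matrix (SlowState Q) (FastState Q) ℝ := fun i j => limitRate Q i j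
  have h : reducedRate Q = QBB + QBA * (1 - fastJump Q)⁻¹ * fastSlowJump Q := rfl
  rw [h, Matrix.add_apply, Matrix.mul_assoc, Matrix.mul_apply]

/-- This is the definition of Γ with the sum split into slow states, where E is the identity, and
fast states, where E = (1 - Ω_AA)⁻¹ Ω_AB. -/
theorem IsTwoTimeScale.limitScaledRate_mul_hittingMatrix_slow (h : IsTwoTimeScale Q)
    (b c : SlowState Q) :
    ∑ j, limitScaledRate Q b j * hittingMatrix Q j c = reducedRate Q b c := by
  simp_rw [limitScaledRate_of_isSlow b.2]
  rw [h.sum_eq]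
  simp_rw [hittingMatrix_fast, hittingMatrix_slow]
  rw [reducedRate_apply, add_comm]
  congr 1
  simp [Matrix.one_apply]

theorem IsTwoTimeScale.limitScaledRate_mul_hittingMatrix_fast (h : IsTwoTimeScale Q) {k : S}
    (hk : IsFast Q k) (c : SlowState Q) :
    ∑ j, limitScaledRate Q k j * hittingMatrix Q j c = 0 := by
  simp_rw [limitScaledRate_of_isFast hk]
  rw [h.sum_eq]
  simp_rw [hittingMatrix_fast, hittingMatrix_slow]
  have h1 : (1 - fastJump Q) * ((1 - fastJump Q)⁻¹ * fastSlowJump Q) = fastSlowJump Q := by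
    rw [← Matrix.mul_assoc, Matrix.mul_nonsing_inv _ h.isUnit_det_sub_fastJump, Matrix.one_mul]
  have h2 := congrFun (congrFun h1 ⟨k, hk⟩) c
  rw [Matrix.mul_apply] at h2
  have h3 : ∀ b : SlowState Q, (1 : Matrix S S ℝ) k b = 0 := fun b =>
    Matrix.one_apply_ne fun hkb => not_isFast_of_isSlow b.2 (hkb ▸ hk)
  have h4 : ∀ a : FastState Q, limitJump Q k a - (1 : Matrix S S ℝ) k a
      = -(1 - fastJump Q) ⟨k, hk⟩ a := fun a => by
    simp [fastJump, Matrix.one_apply, Subtype.ext_iff]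
  simp_rw [h3, h4, neg_mul, Finset.sum_neg_distrib, h2]
  simp [Matrix.one_apply, fastSlowJump]

theorem IsTwoTimeScale.reducedRate_isRateMatrix (h : IsTwoTimeScale Q) :
    IsRateMatrix (reducedRate Q) where
  nonneg b c hbc := by
    rw [← h.limitScaledRate_mul_hittingMatrix_slow]
    refine Finset.sum_nonneg fun j _ => ?_
    by_cases hj : (b : S) = j
    · rw [← hj, hittingMatrix_slow, Matrix.one_apply_ne hbc, mul_zero]
    · exact mul_nonneg (h.limitScaledRate_isRateMatrix.nonneg _ _ hj) (h.hittingMatrix_nonneg j c)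
  row_sum b := by
    simp_rw [← h.limitScaledRate_mul_hittingMatrix_slow]
    rw [Finset.sum_comm]
    simp_rw [← Finset.mul_sum, h.sum_hittingMatrix, mul_one]
    exact h.limitScaledRate_isRateMatrix.row_sum b

/-- The mass of the fast states, weighted with their rates, stays bounded. -/
theorem IsTwoTimeScale.exists_exp_mul_timeScale_le (h : IsTwoTimeScale Q) :
    ∃ y : S → ℝ, ∀ᶠ l in atTop, ∀ i : SlowState Q, ∀ t : ℝ, 0 ≤ t → ∀ k,
      NormedSpace.exp (t • Q l) i k * timeScale Q l k ≤ y k := by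
  classical
  -- C lies strictly above every limiting rate out of a slow state, hence eventually bounds the
  -- rates themselves.
  set C : ℝ := 1 + ∑ k, ∑ a, |limitRate Q k a| with hC
  have hC0 : 0 < C := by
    have : 0 ≤ ∑ k, ∑ a, |limitRate Q k a| :=
      Finset.sum_nonneg fun _ _ => Finset.sum_nonneg fun _ _ => abs_nonneg _
    linarith
  have hCev : ∀ᶠ l in atTop, ∀ k a, IsSlow Q k → Q l k a ≤ C := by
    simp_rw [eventually_all]
    intro k a hk
    have h1 : limitRate Q k a < C := by
      have h2 : |limitRate Q k a| ≤ ∑ k, ∑ a, |limitRate Q k a| :=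
        (Finset.single_le_sum (f := fun a => |limitRate Q k a|) (fun _ _ => abs_nonneg _)
          (Finset.mem_univ a)).trans
        (Finset.single_le_sum (f := fun k => ∑ a, |limitRate Q k a|)
          (fun _ _ => Finset.sum_nonneg fun _ _ => abs_nonneg _) (Finset.mem_univ k))
      linarith [le_abs_self (limitRate Q k a)]
    exact ((h.tendsto_limitRate hk a).eventually_lt_const h1).mono fun l hl => hl.le
  -- On fast states y is the row vector 2C·1ᵀ(1 - Ω_AA)⁻¹, so that y(Ω_AA - 1) = -2C. The factor 2
  -- leaves room for the strict bound -C before the limit. On slow states mass at most one suffices.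
  set y : S → ℝ := fun k =>
    if hk : IsFast Q k then 2 * C * ∑ a, (1 - fastJump Q)⁻¹ a ⟨k, hk⟩ else 1 with hy
  have hyF : ∀ k : FastState Q, y k = 2 * C * ∑ a, (1 - fastJump Q)⁻¹ a k := fun k => by
    simp [hy, k.2]
  have hy0 : ∀ k, 0 ≤ y k := fun k => by
    simp only [hy]
    split_ifs with hk
    · exact mul_nonneg (by positivity)
        (Finset.sum_nonneg fun a _ => h.inv_sub_fastJump_nonneg a _)
    · exact zero_le_one
  have hlim : ∀ a : FastState Q, ∑ k : FastState Q, y k * limitScaledRate Q k a = -(2 * C) := by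
    intro a
    have h1 : ∀ k : FastState Q, limitScaledRate Q k a = -(1 - fastJump Q) k a := fun k => by
      rw [limitScaledRate_of_isFast k.2]
      simp [fastJump, Matrix.one_apply, Subtype.ext_iff]
    simp_rw [h1, hyF, mul_neg, Finset.sum_neg_distrib, mul_assoc, Finset.sum_mul,
      ← Finset.mul_sum]
    rw [Finset.sum_comm]
    have h2 : ∀ b, ∑ k, (1 - fastJump Q)⁻¹ b k * (1 - fastJump Q) k a
        = (1 : Matrix (FastState Q) (FastState Q) ℝ) b a := fun b => by
      rw [← Matrix.mul_apply, Matrix.nonsing_inv_mul _ h.isUnit_det_sub_fastJump]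
    simp_rw [h2]
    simp [Matrix.one_apply]
  have hsup : ∀ᶠ l in atTop, ∀ a : FastState Q,
      ∑ k : FastState Q, y k * scaledRate Q l k a < -C := by
    rw [eventually_all]
    intro a
    have h1 : Tendsto (fun l => ∑ k : FastState Q, y k * scaledRate Q l k a) atTop
        (𝓝 (-(2 * C))) := by
      rw [← hlim a]
      exact tendsto_finsetSum _ fun k _ => (h.tendsto_scaledRate k a).const_mul _
    exact h1.eventually_lt_const (by linarith)
  refine ⟨y, ?_⟩
  filter_upwards [h.eventually_isRateMatrix, eventually_timeScale_pos Q, hCev, hsup]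
    with l hl hpos hCl hsupl i t ht k
  by_cases hk : IsFast Q k
  · rw [← le_div_iff₀ (hpos k)]
    -- Dividing y by the time scale turns the balance inequality for the rescaled rates into one for
    -- Q l.
    refine hl.exp_le_of_supersolution (IsFast Q) (z := fun k => y k / timeScale Q l k) (C := C)
      (fun k => div_nonneg (hy0 k) (hpos k).le)
      (fun k a hk _ => hCl k a (h.not_isFast_iff.1 hk)) (fun a ha => ?_)
      (not_isFast_of_isSlow i.2) hk ht
    rw [h.sum_eq]
    have h1 : ∀ b : SlowState Q, ¬ IsFast Q b := fun b => not_isFast_of_isSlow b.2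
    have h2 : ∀ b : FastState Q, IsFast Q b := fun b => b.2
    simp only [h1, h2, if_true, if_false, Finset.sum_const_zero, add_zero]
    refine le_of_eq_of_le (Finset.sum_congr rfl fun b _ => ?_) (hsupl ⟨a, ha⟩).le
    rw [scaledRate]
    ring
  · simp only [timeScale, hy, hk, if_false, dif_neg, not_false_eq_true, mul_one]
    exact hl.exp_le_one ht i k

theorem IsTwoTimeScale.exists_abs_exp_sub_exp_reducedRate_le (h : IsTwoTimeScale Q)
    (hirr : IsIrreducible (reducedRate Q)) (i j : SlowState Q) :
    ∃ R : ℝ → ℝ, Tendsto R atTop (𝓝 0) ∧ ∀ᶠ l in atTop, ∀ t : ℝ, 0 ≤ t →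
      |NormedSpace.exp (t • Q l) i j - NormedSpace.exp (t • reducedRate Q) i j| ≤ R l := by
  classical
  have hΓ := h.reducedRate_isRateMatrix
  obtain ⟨K, α, hα, hK, hdecay⟩ := hΓ.exists_exp_decay hirr
  obtain ⟨y, hy⟩ := h.exists_exp_mul_timeScale_le
  set K₁ : ℝ := ∑ b, ∑ c, |reducedRate Q b c| with hK₁
  set ε : ℝ → ℝ := fun l => ∑ k, ∑ j, |scaledRate Q l k j - limitScaledRate Q k j| with hε
  set δ : ℝ → ℝ := fun l => ∑ a : FastState Q, 1 / timeScale Q l a with hδ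
  have hε0 : Tendsto ε atTop (𝓝 0) := by
    have : Tendsto ε atTop (𝓝 (∑ k : S, ∑ j : S, (0 : ℝ))) :=
      tendsto_finsetSum _ fun k _ => tendsto_finsetSum _ fun j _ => by
        have := ((h.tendsto_scaledRate k j).sub_const (limitScaledRate Q k j)).abs
        simpa using this
    simpa using this
  have hδ0 : Tendsto δ atTop (𝓝 0) := by
    have : Tendsto δ atTop (𝓝 (∑ a : FastState Q, (0 : ℝ))) :=
      tendsto_finsetSum _ fun a _ => by
        have := tendsto_inv_atTop_zero.comp a.2
        simpa [timeScale, a.2, Function.comp_def] using this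
    simpa using this
  refine ⟨fun l => (∑ k, y k) * (ε l + K₁ * δ l) * (K / α) + (∑ k, y k) * δ l, ?_, ?_⟩
  · have h1 := (((hε0.add (hδ0.const_mul K₁)).const_mul (∑ k, y k)).mul_const (K / α)).add
      (hδ0.const_mul (∑ k, y k))
    simpa using h1
  · filter_upwards [h.eventually_isRateMatrix, eventually_timeScale_pos Q, hy]
      with l hl hpos hyl t ht
    have hrange : ∀ k, k ∉ Set.range (Subtype.val : SlowState Q → S) → IsFast Q k := fun k hk =>
      (h.isSlow_or_isFast k).resolve_left fun hs => hk ⟨⟨k, hs⟩, rfl⟩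
    refine abs_exp_sub_exp_reduced_le (M := limitScaledRate Q) (M' := scaledRate Q l)
      (E := hittingMatrix Q) (d := timeScale Q l) (ι := Subtype.val)
      (ε := ε l) (δ := δ l) (K₁ := K₁) hl hpos
      (fun k j => ?_) h.limitScaledRate_isRateMatrix.row_sum (fun k => ?_)
      (Finset.sum_nonneg fun a _ => one_div_nonneg.2 (hpos a).le) (fun k hk => ?_) (fun b => ?_)
      h.hittingMatrix_nonneg h.sum_hittingMatrix hittingMatrix_slow
      h.limitScaledRate_mul_hittingMatrix_slow
      (fun k hk => h.limitScaledRate_mul_hittingMatrix_fast (hrange k hk)) hΓ (fun b => ?_)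
      (Finset.sum_nonneg fun _ _ => Finset.sum_nonneg fun _ _ => abs_nonneg _) hα hK
      (fun t ht x y => ?_) (hyl i) ht
    · rw [scaledRate, mul_div_cancel₀ _ (hpos k).ne']
    · exact Finset.single_le_sum
        (f := fun k => ∑ j, |scaledRate Q l k j - limitScaledRate Q k j|)
        (fun _ _ => Finset.sum_nonneg fun _ _ => abs_nonneg _) (Finset.mem_univ k)
    · exact Finset.single_le_sum (f := fun a : FastState Q => 1 / timeScale Q l a)
        (fun a _ => one_div_nonneg.2 (hpos a).le) (Finset.mem_univ ⟨k, hrange k hk⟩)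
    · simp [timeScale, not_isFast_of_isSlow b.2]
    · exact Finset.single_le_sum (f := fun b => ∑ c, |reducedRate Q b c|)
        (fun _ _ => Finset.sum_nonneg fun _ _ => abs_nonneg _) (Finset.mem_univ b)
    · have := hdecay (Pi.single j 1) (fun a b => ?_) t ht x y
      · simpa [Pi.single_apply] using this
      · simp only [Pi.single_apply]
        split_ifs <;> norm_num

end Reduction

/-! ### From processes to transition matrices -/

/-- The Markov property is used at the times 0 and t only, and the initial event has probability
one. The claim thereby becomes one about matrix exponentials. -/
theorem IsMarkovChain.real_eq {S : Type*} [Fintype S] [DecidableEq S] {Ω : Type*}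
    [MeasurableSpace Ω] {G : Matrix S S ℝ} {i : S} {P : Measure Ω} {X : ℝ≥0 → Ω → S}
    (h : IsMarkovChain G i P X) (t : ℝ≥0) (j : S) :
    P.real {ω | X t ω = j} = NormedSpace.exp ((t : ℝ) • G) i j := by
  have := h.isProbabilityMeasure
  have hm := h.markov 0 (fun n => if n = 0 then 0 else t)
    (fun m n hmn => by
      rcases Nat.eq_zero_or_pos m with rfl | hm
      · simp
      · simp [hm.ne', (hm.trans_le hmn).ne'])
    (fun n => if n = 0 then i else j)
  have h0 : P.real {ω | X 0 ω = i}ᶜ = 0 := by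
    rw [probReal_compl_eq_one_sub (h.measurableSet_eq 0 i), h.start, sub_self]
  have h1 : {ω | ∀ k ≤ 0, X ((fun n => if n = 0 then 0 else t) k) ω
      = (fun n => if n = 0 then i else j) k} = {ω | X 0 ω = i} := by
    ext ω; simp
  have h2 : {ω | ∀ k ≤ 0 + 1, X ((fun n => if n = 0 then 0 else t) k) ω
      = (fun n => if n = 0 then i else j) k} = {ω | X t ω = j} ∩ {ω | X 0 ω = i} := by
    ext ω
    constructor
    · intro hω
      exact ⟨by simpa using hω 1 le_rfl, by simpa using hω 0 (Nat.zero_le _)⟩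
    · rintro ⟨ha, hb⟩ k hk
      interval_cases k
      · simpa using hb
      · simpa using ha
  rw [h1, h2, h.start, one_mul] at hm
  have h3 := measureReal_inter_add_sdiff (μ := P) (s := {ω | X t ω = j}) (h.measurableSet_eq 0 i)
  have h4 : P.real ({ω | X t ω = j} \ {ω | X 0 ω = i}) = 0 :=
    le_antisymm ((measureReal_mono (fun ω hω => hω.2)).trans h0.le) measureReal_nonneg
  rw [h4, add_zero, hm] at h3
  rw [← h3]
  simp

/-- The limit jump chain of the example is deterministic, so a one-point space realizes it. -/
theorem isDiscreteMarkovChain_iterate {S : Type*} [DecidableEq S] (f : S → S) (i : S) :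
    IsDiscreteMarkovChain (fun a b => if b = f a then (1 : ℝ) else 0) i
      (Measure.dirac ()) (fun n _ => f^[n] i) where
  isProbabilityMeasure := inferInstance
  measurableSet_eq _ _ := MeasurableSet.const _
  start := by simp
  markov n s := by
    by_cases hA : ∀ k ≤ n, f^[k] i = s k
    · have h1 : (∀ k ≤ n + 1, f^[k] i = s k) ↔ s (n + 1) = f (s n) := by
        rw [← hA n le_rfl, ← Function.iterate_succ_apply' f n i]
        refine ⟨fun h => (h (n + 1) le_rfl).symm, fun h k hk => ?_⟩
        rcases Nat.le_succ_iff.1 hk with hk | rfl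
        · exact hA k hk
        · exact h.symm
      by_cases hB : s (n + 1) = f (s n)
      · have h2 : (∀ k ≤ n, f^[k] i = s k) ↔ True := iff_true_intro hA
        simp only [h1, h2, hB]
        simp
      · simp [h1, hB]
    · have h1 : ¬ ∀ k ≤ n + 1, f^[k] i = s k := fun h => hA fun k hk => h k (by omega)
      simp only [hA, h1]
      simp

/-! ### The counterexample with a reducible reduced chain -/

section Example

/-- The successor of a state in the limit of the jump chains of `exampleRate`. -/
def exampleNext : Fin 4 → Fin 4 := ![2, 3, 0, 1]

theorem tendsto_jumpMatrix_exampleRate (i j : Fin 4) :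
    Tendsto (fun l => jumpMatrix (exampleRate l) i j) atTop
      (𝓝 (if j = exampleNext i then 1 else 0)) := by
  have hinv : Tendsto (fun l : ℝ => (l + 1)⁻¹) atTop (𝓝 0) :=
    tendsto_inv_atTop_zero.comp (tendsto_atTop_add_const_right _ _ tendsto_id)
  have h1 : Tendsto (fun l : ℝ => l / (l + 1)) atTop (𝓝 1) := by
    have : Tendsto (fun l : ℝ => 1 - (l + 1)⁻¹) atTop (𝓝 1) := by simpa using hinv.const_sub 1
    refine this.congr' ?_
    filter_upwards [eventually_gt_atTop 0] with l hl
    field_simp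
    ring
  have h2 : Tendsto (fun l : ℝ => (l⁻¹ + 1)⁻¹) atTop (𝓝 1) := by
    have := (tendsto_inv_atTop_zero (𝕜 := ℝ)).add_const 1
    simpa using this.inv₀ (by norm_num)
  have h3 : Tendsto (fun l : ℝ => l⁻¹ / (l⁻¹ + 1)) atTop (𝓝 0) := by
    have := (tendsto_inv_atTop_zero (𝕜 := ℝ)).mul h2
    simpa [div_eq_mul_inv] using this
  fin_cases i <;> fin_cases j <;>
    simp [jumpMatrix, exampleRate, exampleNext, hinv, h1, h2, h3, -neg_add_rev]

theorem limitJump_exampleRate :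
    limitJump exampleRate = fun i j => if j = exampleNext i then 1 else 0 := by
  ext i j
  exact (tendsto_jumpMatrix_exampleRate i j).limUnder_eq

theorem isFast_exampleRate {i : Fin 4} (hi : i = 0 ∨ i = 1) : IsFast exampleRate i := by
  have : Tendsto (fun l : ℝ => l + 1) atTop atTop :=
    tendsto_atTop_add_const_right _ _ tendsto_id
  rcases hi with rfl | rfl <;> simpa [IsFast, exampleRate, -neg_add_rev] using this

theorem tendsto_exampleRate_slow {i : Fin 4} (hi : i = 2 ∨ i = 3) :
    Tendsto (fun l => -exampleRate l i i) atTop (𝓝 1) := by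
  have : Tendsto (fun l : ℝ => l⁻¹ + 1) atTop (𝓝 1) := by
    simpa using (tendsto_inv_atTop_zero (𝕜 := ℝ)).add_const 1
  rcases hi with rfl | rfl <;> simpa [exampleRate, -neg_add_rev] using this

theorem isSlow_exampleRate {i : Fin 4} (hi : i = 2 ∨ i = 3) : IsSlow exampleRate i :=
  ⟨1, tendsto_exampleRate_slow hi⟩

theorem exampleRate_cases (i : Fin 4) : (i = 0 ∨ i = 1) ∨ (i = 2 ∨ i = 3) := by
  fin_cases i <;> simp

theorem isRateMatrix_exampleRate {l : ℝ} (hl : 0 < l) : IsRateMatrix (exampleRate l) where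
  nonneg i j hij := by
    have := inv_pos.2 hl
    fin_cases i <;> fin_cases j <;> simp [exampleRate, hl.le] at hij ⊢
  row_sum i := by
    fin_cases i <;> simp [exampleRate, Fin.sum_univ_four] <;> abel

theorem isIrreducible_exampleRate {l : ℝ} (hl : 0 < l) : IsIrreducible (exampleRate l) := by
  have h01 : (0 : Fin 4) ≠ 1 ∧ 0 < exampleRate l 0 1 := by simp [exampleRate]
  have h13 : (1 : Fin 4) ≠ 3 ∧ 0 < exampleRate l 1 3 := by simp [exampleRate, hl]
  have h32 : (3 : Fin 4) ≠ 2 ∧ 0 < exampleRate l 3 2 := by simp [exampleRate, hl]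
  have h20 : (2 : Fin 4) ≠ 0 ∧ 0 < exampleRate l 2 0 := by simp [exampleRate]
  have to0 : ∀ i, Relation.ReflTransGen (fun a b => a ≠ b ∧ 0 < exampleRate l a b) i 0 := by
    have h2 := Relation.ReflTransGen.single (r := fun a b => a ≠ b ∧ 0 < exampleRate l a b) h20
    have h3 := Relation.ReflTransGen.head (r := fun a b => a ≠ b ∧ 0 < exampleRate l a b) h32 h2
    have h1 := Relation.ReflTransGen.head (r := fun a b => a ≠ b ∧ 0 < exampleRate l a b) h13 h3
    intro i
    fin_cases i
    exacts [Relation.ReflTransGen.refl, h1, h2, h3]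
  have from0 : ∀ i, Relation.ReflTransGen (fun a b => a ≠ b ∧ 0 < exampleRate l a b) 0 i := by
    have h1 := Relation.ReflTransGen.single (r := fun a b => a ≠ b ∧ 0 < exampleRate l a b) h01
    have h3 := h1.tail h13
    have h2 := h3.tail h32
    intro i
    fin_cases i
    exacts [Relation.ReflTransGen.refl, h1, h2, h3]
  exact fun i j => (to0 i).trans (from0 j)

theorem isTwoTimeScale_exampleRate : IsTwoTimeScale exampleRate where
  isRateMatrix _ := isRateMatrix_exampleRate
  isIrreducible _ := isIrreducible_exampleRate
  tendsto_rate i j hij := by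
    have h0 := tendsto_inv_atTop_zero (𝕜 := ℝ)
    have hid : Tendsto (fun l : ℝ => l) atTop atTop := tendsto_id
    fin_cases i <;> fin_cases j <;>
      first
      | exact absurd rfl hij
      | (refine Or.inr ?_; simpa [exampleRate] using hid)
      | (refine Or.inl ⟨0, ?_⟩; simp [exampleRate, h0]; done)
      | (refine Or.inl ⟨1, ?_⟩; simp [exampleRate])
  tendsto_jump i j _ := ⟨_, tendsto_jumpMatrix_exampleRate i j⟩
  exists_slow := ⟨2, isSlow_exampleRate (Or.inl rfl)⟩
  slow_pos i c hc := by
    rcases exampleRate_cases i with hi | hi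
    · exact absurd (isFast_exampleRate hi) (not_isFast_of_isSlow ⟨c, hc⟩)
    · rw [tendsto_nhds_unique hc (tendsto_exampleRate_slow hi)]
      exact one_pos
  hits_slow i hi := by
    refine ⟨Unit, inferInstance, Measure.dirac (), fun n _ => exampleNext^[n] i, ?_, ?_⟩
    · rw [limitJump_exampleRate]
      exact isDiscreteMarkovChain_iterate exampleNext i
    · have h1 : IsSlow exampleRate (exampleNext^[1] i) := by
        rcases exampleRate_cases i with h | h
        · apply isSlow_exampleRate
          rcases h with rfl | rfl <;> simp [exampleNext]
        · exact absurd hi (not_isFast_of_isSlow (isSlow_exampleRate h))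
      have h2 : ∃ n, IsSlow exampleRate (exampleNext^[n] i) := ⟨1, h1⟩
      simp [h2]

/-- Each fast state jumps directly to a slow one in the limit, so Ω_AA = 0 and the inverse
disappears. -/
theorem hittingMatrix_exampleRate (k : Fin 4) (c : SlowState exampleRate) :
    hittingMatrix exampleRate k c
      = if (c : Fin 4) = (if k = 0 ∨ k = 1 then exampleNext k else k) then 1 else 0 := by
  rcases exampleRate_cases k with hk | hk
  · have hzero : fastJump exampleRate = 0 := by
      ext a b
      simp only [fastJump, limitJump_exampleRate, Matrix.zero_apply, ite_eq_right_iff]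
      intro hab
      exfalso
      refine not_isFast_of_isSlow (isSlow_exampleRate ?_) b.2
      rw [hab]
      rcases exampleRate_cases a with ha | ha
      · rcases ha with ha | ha <;> simp [ha, exampleNext]
      · exact absurd a.2 (not_isFast_of_isSlow (isSlow_exampleRate ha))
    obtain ⟨a, rfl⟩ : ∃ a : FastState exampleRate, (a : Fin 4) = k :=
      ⟨⟨k, isFast_exampleRate hk⟩, rfl⟩
    rw [hittingMatrix_fast, hzero, sub_zero, inv_one, Matrix.one_mul, if_pos hk, fastSlowJump,
      limitJump_exampleRate]
  · obtain ⟨b, rfl⟩ : ∃ b : SlowState exampleRate, (b : Fin 4) = k :=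
      ⟨⟨k, isSlow_exampleRate hk⟩, rfl⟩
    have h1 : ¬ ((b : Fin 4) = 0 ∨ (b : Fin 4) = 1) := by
      rcases hk with hk | hk <;> simp [hk]
    rw [hittingMatrix_slow, if_neg h1, Matrix.one_apply]
    simp [Subtype.ext_iff, eq_comm]

/-- Every excursion from 2 through 0, or from 3 through 1, returns to its starting point, and the
direct rates 1/l between 2 and 3 vanish. -/
theorem reducedRate_exampleRate : reducedRate exampleRate = 0 := by
  ext b c
  have hz : Tendsto (fun l : ℝ => l⁻¹) atTop (𝓝 0) := tendsto_inv_atTop_zero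
  have hd : Tendsto (fun l : ℝ => -(l⁻¹ + 1)) atTop (𝓝 (-1)) := by
    simpa using (hz.add_const 1).neg
  rw [← isTwoTimeScale_exampleRate.limitScaledRate_mul_hittingMatrix_slow]
  simp_rw [limitScaledRate_of_isSlow b.2, hittingMatrix_exampleRate]
  have hlim : ∀ {i j : Fin 4} {x : ℝ}, Tendsto (fun l => exampleRate l i j) atTop (𝓝 x) →
      limitRate exampleRate i j = x := fun h => h.limUnder_eq
  rcases exampleRate_cases b with hb | hb
  · exact absurd (isFast_exampleRate hb) (not_isFast_of_isSlow b.2)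
  · rcases hb with hb | hb
    · have h0 : limitRate exampleRate 2 0 = 1 := hlim (by simp [exampleRate])
      have h1 : limitRate exampleRate 2 1 = 0 := hlim (by simp [exampleRate])
      have h2 : limitRate exampleRate 2 2 = -1 :=
        hlim (by simpa [exampleRate, -neg_add_rev] using hd)
      have h3 : limitRate exampleRate 2 3 = 0 := hlim (by simpa [exampleRate] using hz)
      simp [hb, Fin.sum_univ_four, h0, h1, h2, h3, exampleNext]
      split_ifs <;> norm_num
    · have h0 : limitRate exampleRate 3 0 = 0 := hlim (by simp [exampleRate])
      have h1 : limitRate exampleRate 3 1 = 1 := hlim (by simp [exampleRate])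
      have h2 : limitRate exampleRate 3 2 = 0 := hlim (by simpa [exampleRate] using hz)
      have h3 : limitRate exampleRate 3 3 = -1 :=
        hlim (by simpa [exampleRate, -neg_add_rev] using hd)
      simp [hb, Fin.sum_univ_four, h0, h1, h2, h3, exampleNext]
      split_ifs <;> norm_num

theorem not_isIrreducible_reducedRate_exampleRate :
    ¬ IsIrreducible (reducedRate exampleRate) := by
  intro hirr
  rcases (hirr ⟨2, isSlow_exampleRate (Or.inl rfl)⟩
    ⟨3, isSlow_exampleRate (Or.inr rfl)⟩).cases_head with h | ⟨c, hc, _⟩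
  · simp at h
  · rw [reducedRate_exampleRate] at hc
    exact lt_irrefl _ hc.2

/-- For fixed l the chain forgets its initial state, so after a long time, depending on l, its law
is close to the normalized invariant measure, which gives state 3 mass l / (2 + 2l) ≥ 1/4. -/
theorem exists_le_exp_exampleRate {l : ℝ} (hl : 1 ≤ l) :
    ∃ t : ℝ≥0, 1 / 8 ≤ NormedSpace.exp ((t : ℝ) • exampleRate l) 2 3 := by
  have hl0 : 0 < l := by linarith
  have hG := isRateMatrix_exampleRate hl0
  obtain ⟨K, α, hα, _, hdecay⟩ := hG.exists_exp_decay (isIrreducible_exampleRate hl0)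
  have hlim : Tendsto (fun t : ℝ => K * Real.exp (-α * t)) atTop (𝓝 0) := by
    have h1 : Tendsto (fun t : ℝ => -α * t) atTop atBot :=
      tendsto_id.const_mul_atTop_of_neg (by linarith)
    simpa using (Real.tendsto_exp_atBot.comp h1).const_mul K
  obtain ⟨t, ht, htK⟩ := ((eventually_ge_atTop 0).and
    (hlim.eventually_lt_const (show (0 : ℝ) < 1 / 8 by norm_num))).exists
  refine ⟨⟨t, ht⟩, ?_⟩
  show 1 / 8 ≤ NormedSpace.exp (t • exampleRate l) 2 3
  have hosc : ∀ k, NormedSpace.exp (t • exampleRate l) k 3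
      ≤ NormedSpace.exp (t • exampleRate l) 2 3 + 1 / 8 := by
    intro k
    have h1 := hdecay (Pi.single 3 1) (fun a b => by
      simp only [Pi.single_apply]
      split_ifs <;> norm_num) t ht k 2
    have h2 : |NormedSpace.exp (t • exampleRate l) k 3
        - NormedSpace.exp (t • exampleRate l) 2 3| ≤ K * Real.exp (-α * t) := by
      simpa [Pi.single_apply] using h1
    linarith [(le_abs_self _).trans h2]
  have hinv := sum_mul_exp_smul_eq (G := exampleRate l) (p := ![1, 1, l, l]) (fun j => by
    fin_cases j <;> simp [Fin.sum_univ_four, exampleRate] <;> field_simp <;> ring) t 3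
  simp only [Fin.sum_univ_four, Matrix.cons_val] at hinv
  -- If the entry were below 1/8, the invariance identity would give l < 1/4 + 1/4 + l/8 + l/4,
  -- which is impossible for l ≥ 1.
  by_contra! hlt
  nlinarith [hosc 0, hosc 1, mul_le_mul_of_nonneg_left (hosc 3) hl0.le,
    mul_lt_mul_of_pos_left hlt hl0]

end Example

theorem abs_real_sub_real_le_one {Ω Ω' : Type*} [MeasurableSpace Ω] [MeasurableSpace Ω']
    {P : Measure Ω} {P' : Measure Ω'} (hP : IsProbabilityMeasure P)
    (hP' : IsProbabilityMeasure P') (s : Set Ω) (s' : Set Ω') : |P.real s - P'.real s'| ≤ 1 := by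
  rw [abs_sub_le_iff]
  constructor <;> linarith [measureReal_nonneg (μ := P) (s := s), measureReal_le_one (μ := P) (s := s),
    measureReal_nonneg (μ := P') (s := s'), measureReal_le_one (μ := P') (s := s')]

end TwoTimeScale

theorem theorem3 :
    -- the convergence is uniform on the whole time axis if the reduced chain is irreducible
    (∀ (S : Type u) [Fintype S] [DecidableEq S] (Q : ℝ → Matrix S S ℝ),
      TwoTimeScale.IsTwoTimeScale Q →
      TwoTimeScale.IsIrreducible (TwoTimeScale.reducedRate Q) →
      ∀ (i j : TwoTimeScale.SlowState Q)
        (Ω : ℝ → Type v) [∀ l, MeasurableSpace (Ω l)]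
        (P : ∀ l, Measure (Ω l)) (X : ∀ l, ℝ≥0 → Ω l → S)
        (Ω' : Type w) [MeasurableSpace Ω']
        (P' : Measure Ω') (Y : ℝ≥0 → Ω' → TwoTimeScale.SlowState Q),
        (∀ l > 0, TwoTimeScale.IsMarkovChain (Q l) (i : S) (P l) (X l)) →
        TwoTimeScale.IsMarkovChain (TwoTimeScale.reducedRate Q) i P' Y →
        Tendsto
          (fun l => ⨆ t : ℝ≥0,
            |(P l).real {ω | X l t ω = (j : S)} - P'.real {ω | Y t ω = j}|)
          atTop (𝓝 0)) ∧
    -- without irreducibility of the reduced chain this fails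
    (TwoTimeScale.IsTwoTimeScale TwoTimeScale.exampleRate ∧
      ¬ TwoTimeScale.IsIrreducible (TwoTimeScale.reducedRate TwoTimeScale.exampleRate) ∧
      ∃ i j : TwoTimeScale.SlowState TwoTimeScale.exampleRate, (i : Fin 4) = 2 ∧ (j : Fin 4) = 3 ∧
      ∀ (Ω : ℝ → Type v) [∀ l, MeasurableSpace (Ω l)]
        (P : ∀ l, Measure (Ω l)) (X : ∀ l, ℝ≥0 → Ω l → Fin 4)
        (Ω' : Type w) [MeasurableSpace Ω']
        (P' : Measure Ω') (Y : ℝ≥0 → Ω' → TwoTimeScale.SlowState TwoTimeScale.exampleRate),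
        (∀ l > 0,
          TwoTimeScale.IsMarkovChain (TwoTimeScale.exampleRate l) (i : Fin 4) (P l) (X l)) →
        TwoTimeScale.IsMarkovChain
          (TwoTimeScale.reducedRate TwoTimeScale.exampleRate) i P' Y →
        ¬ Tendsto
          (fun l => ⨆ t : ℝ≥0,
            |(P l).real {ω | X l t ω = (j : Fin 4)} - P'.real {ω | Y t ω = j}|)
          atTop (𝓝 0)) := by
  refine ⟨?_, TwoTimeScale.isTwoTimeScale_exampleRate,
    TwoTimeScale.not_isIrreducible_reducedRate_exampleRate,
    ⟨2, TwoTimeScale.isSlow_exampleRate (Or.inl rfl)⟩,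
    ⟨3, TwoTimeScale.isSlow_exampleRate (Or.inr rfl)⟩, rfl, rfl, ?_⟩
  · intro S _ _ Q h hirr i j Ω _ P X Ω' _ P' Y hX hY
    obtain ⟨R, hR, hbound⟩ := h.exists_abs_exp_sub_exp_reducedRate_le hirr i j
    refine squeeze_zero' (Eventually.of_forall fun l => Real.iSup_nonneg fun t => abs_nonneg _)
      ?_ hR
    filter_upwards [hbound, eventually_gt_atTop 0] with l hl hl0
    refine ciSup_le fun t => ?_
    rw [(hX l hl0).real_eq, hY.real_eq]
    exact hl t t.2
  · intro Ω _ P X Ω' _ P' Y hX hY hlim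
    obtain ⟨l, hl1, hl⟩ := ((eventually_ge_atTop 1).and
      (hlim.eventually_lt_const (show (0 : ℝ) < 1 / 8 by norm_num))).exists
    have hl0 : 0 < l := by linarith
    obtain ⟨t, ht⟩ := TwoTimeScale.exists_le_exp_exampleRate hl1
    -- The supremum of an unbounded real family is 0 by default, so the bound 1 is needed before the
    -- value at t can be compared with it.
    have hbdd := le_ciSup (f := fun t : ℝ≥0 => |(P l).real {ω | X l t ω = 3}
      - P'.real {ω | Y t ω = ⟨3, TwoTimeScale.isSlow_exampleRate (Or.inr rfl)⟩}|)
      ⟨1, by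
        rintro _ ⟨s, rfl⟩
        exact TwoTimeScale.abs_real_sub_real_le_one (hX l hl0).isProbabilityMeasure
          hY.isProbabilityMeasure _ _⟩ t
    simp only [(hX l hl0).real_eq t, hY.real_eq t, TwoTimeScale.reducedRate_exampleRate, smul_zero,
      NormedSpace.exp_zero] at hbdd
    rw [Matrix.one_apply_ne (by simp), sub_zero] at hbdd
    linarith [(le_abs_self _).trans hbdd]
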